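/- Let $m>1$ be an integer. Consider the elliptic curves over $\mathbf{Q}$ $$E_m\colon y^2=x^3-x+m^6\qquad\text{and}\qquad E'_m\colon y^2=x^3+x-m^6 .$$ Then 1. $E_m$ has rank at least $3$, and 2. $E'_m$ has rank at least $2$, where the rank of an elliptic curve $E$ over $\mathbf{Q}$ is the rank of the abelian group $E(\mathbf{Q})$ of its rational points. -/

import Mathlib

/-- The curve `E_m : y² = x³ - x + m⁶` over `ℚ`. -/
def curveE (m : ℤ) : WeierstrassCurve ℚ where
  a₁ := 0
  a₂ := 0
  a₃ := 0
  a₄ := -1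
  a₆ := (m : ℚ) ^ 6

/-- The curve `E'_m : y² = x³ + x - m⁶` over `ℚ`. -/
def curveE' (m : ℤ) : WeierstrassCurve ℚ where
  a₁ := 0
  a₂ := 0
  a₃ := 0
  a₄ := 1
  a₆ := -(m : ℚ) ^ 6

theorem curveE_equation (m : ℤ) (x y : ℚ) :
    (curveE m).toAffine.Equation x y ↔ y ^ 2 = x ^ 3 - x + (m : ℚ) ^ 6 := by
  rw [WeierstrassCurve.Affine.equation_iff]
  simp [curveE, sub_eq_add_neg]

theorem curveE'_equation (m : ℤ) (x y : ℚ) :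
    (curveE' m).toAffine.Equation x y ↔ y ^ 2 = x ^ 3 + x - (m : ℚ) ^ 6 := by
  rw [WeierstrassCurve.Affine.equation_iff]
  simp [curveE', sub_eq_add_neg]

/-- `E_m` is nonsingular, i.e. an elliptic curve: its discriminant is `16 (4 - 27 m¹²) ≠ 0`. -/
instance curveE_isElliptic (m : ℤ) : (curveE m).IsElliptic := by
  refine ⟨isUnit_iff_ne_zero.mpr fun h => ?_⟩
  have h1 : (4 : ℚ) - 27 * (m : ℚ) ^ 12 = 0 := by
    have h2 : (curveE m).Δ = 16 * (4 - 27 * (m : ℚ) ^ 12) := by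
      simp only [WeierstrassCurve.Δ, WeierstrassCurve.b₂, WeierstrassCurve.b₄,
        WeierstrassCurve.b₆, WeierstrassCurve.b₈, curveE]
      ring
    rw [h2] at h
    linarith
  have h3 : (4 : ℤ) - 27 * m ^ 12 = 0 := by exact_mod_cast h1
  omega

/-- `E'_m` is nonsingular, i.e. an elliptic curve: its discriminant is `-16 (4 + 27 m¹²) ≠ 0`. -/
instance curveE'_isElliptic (m : ℤ) : (curveE' m).IsElliptic := by
  refine ⟨isUnit_iff_ne_zero.mpr fun h => ?_⟩
  have h2 : (curveE' m).Δ = -16 * (4 + 27 * (m : ℚ) ^ 12) := by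
    simp only [WeierstrassCurve.Δ, WeierstrassCurve.b₂, WeierstrassCurve.b₄,
      WeierstrassCurve.b₆, WeierstrassCurve.b₈, curveE']
    ring
  have h3 : 0 ≤ (m : ℚ) ^ 12 := by positivity
  rw [h2] at h
  linarith

/-- The (Mordell–Weil) rank of an elliptic curve `E` over `ℚ`: the rank of the abelian group
`E(ℚ)`, i.e. the supremum of the sizes of its `ℤ`-linearly independent families. It is a cardinal,
so no default value occurs and no finiteness of `E(ℚ)` has to be known. -/
noncomputable def mordellWeilRank (E : WeierstrassCurve ℚ) [E.IsElliptic] : Cardinal :=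
  Module.rank ℤ E.toAffine.Point

/-! On `E_m` take `P = (0, m³)`, `Q = (1, m³)`, `R = (-m², m)`; on `E'_m` take `P = (m², m)`, `Q =
(m⁶, m⁹)`. These families are shown to be independent. Neither curve has a rational point of order
two, so a relation with even coefficients can be halved; by `linearIndependent_int_of_two_dvd` it is
enough that no nonzero combination modulo 2 lies in `2E(ℚ)`. This leaves seven points on `E_m` and
three on `E'_m`.

If `(x, y) = 2T` on `y² = x³ + a₄x + a₆`, the slope `s` of the tangent at `T` satisfies `s⁴ - 6xs² -
8ys - 3x² - 4a₄ = 0` (`exists_slope_of_eq_add_self`). For the points at hand this quartic is monic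
with integer coefficients, after scaling `s` by `±m` in two cases, so the root is an integer and a
Diophantine equation in `s` and `m` remains.

Six of the ten equations fall to congruences or divisibility. The others need more: `R` leads to
Euler's `x⁴ + x²y² + y⁴ = z²`, and `R - (P + Q)` to `a⁴ - 2a²b² + 4b⁴ = D²`, both settled by
descent; for `R - P` a resultant argument leaves finitely many cases; `P + Q` on `E'_m` leads to `z²
= 3u² + 1` and then to `b⁴ + c⁴ = 2a²`, `b⁴ + c⁴ = a²` and `a⁴ = 1 + 108b⁸`.

The case `m = 1` is a true exception: there `R = -(P + Q)` on `E_m` and `P = Q` on `E'_m`. -/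

/-! ### Coprime factors of powers. -/

/-- Two coprime integers whose product is an `n`-th power, `n` even, are `n`-th powers up to a
common sign. -/
theorem Int.exists_pow_of_isCoprime_mul {r s w : ℤ} {n : ℕ} (hn : Even n)
    (h : IsCoprime r s) (e : r * s = w ^ n) :
    ∃ x y : ℤ, r = x ^ n ∧ s = y ^ n ∨ r = -x ^ n ∧ s = -y ^ n := by
  obtain ⟨x, hx⟩ := exists_associated_pow_of_mul_eq_pow' h e
  obtain ⟨y, hy⟩ := exists_associated_pow_of_mul_eq_pow' h.symm (mul_comm r s ▸ e)
  have hxn := hn.pow_nonneg x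
  have hyn := hn.pow_nonneg y
  have hwn := hn.pow_nonneg w
  rw [Int.associated_iff] at hx hy
  rcases hx with hx | hx <;> rcases hy with hy | hy
  · exact ⟨x, y, .inl ⟨hx.symm, hy.symm⟩⟩
  · have h0 : x ^ n * y ^ n = 0 := by
      have := mul_nonneg hxn hyn
      rw [hx] at this ⊢
      nlinarith
    rcases mul_eq_zero.1 h0 with h1 | h1
    · exact ⟨x, y, .inr ⟨by linarith, by linarith⟩⟩
    · exact ⟨x, y, .inl ⟨by linarith, by linarith⟩⟩
  · have h0 : x ^ n * y ^ n = 0 := by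
      have := mul_nonneg hxn hyn
      rw [hy] at this ⊢
      nlinarith
    rcases mul_eq_zero.1 h0 with h1 | h1
    · exact ⟨x, y, .inl ⟨by linarith, by linarith⟩⟩
    · exact ⟨x, y, .inr ⟨by linarith, by linarith⟩⟩
  · exact ⟨x, y, .inr ⟨by linarith, by linarith⟩⟩

theorem Int.exists_pow_of_isCoprime_mul_of_nonneg {r s w : ℤ} {n : ℕ} (hn : Even n)
    (h : IsCoprime r s) (e : r * s = w ^ n) (hr : 0 ≤ r) (hs : 0 ≤ s) :
    ∃ x y : ℤ, r = x ^ n ∧ s = y ^ n := by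
  obtain ⟨x, y, h | ⟨h1, h2⟩⟩ := Int.exists_pow_of_isCoprime_mul hn h e
  · exact ⟨x, y, h⟩
  · have := hn.pow_nonneg x
    have := hn.pow_nonneg y
    exact ⟨x, y, by linarith, by linarith⟩

theorem Int.isCoprime_of_forall_prime {a b : ℤ}
    (h : ∀ p : ℤ, Prime p → p ∣ a → p ∣ b → False) : IsCoprime a b := by
  refine isCoprime_of_prime_dvd ?_ fun p hp ha hb => h p hp ha hb
  rintro ⟨rfl, rfl⟩
  exact h 2 Int.prime_two (dvd_zero _) (dvd_zero _)

theorem IsCoprime.false_of_prime_dvd {a b p : ℤ} (h : IsCoprime a b) (hp : Prime p) (ha : p ∣ a)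
    (hb : p ∣ b) : False :=
  hp.not_isUnit (h.isUnit_of_dvd' ha hb)

theorem Int.eight_dvd_sq_sub_one {s : ℤ} (hs : ¬ 2 ∣ s) : ∃ i, s ^ 2 = 8 * i + 1 := by
  obtain ⟨i, hi⟩ := Int.eight_dvd_sq_sub_one_of_odd (k := s)
    (by rwa [← Int.not_even_iff_odd, even_iff_two_dvd])
  exact ⟨i, by linarith⟩

/-! ### Quartic equations solved by infinite descent. -/

/-- `u² + v²` and `u² - v²` are not both squares for coprime `u`, `v` with `v ≠ 0`. -/
theorem Int.eq_zero_of_sq_add_sq_sub (n : ℕ) : ∀ {u v a e : ℤ}, v.natAbs = n → IsCoprime u v →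
    u ^ 2 + v ^ 2 = a ^ 2 → u ^ 2 - v ^ 2 = e ^ 2 → v = 0 := by
  induction n using Nat.strong_induction_on with
  | _ n ih =>
  intro u v a e hvn huv h1 h2
  wlog ha : 0 ≤ a
  · exact this n ih hvn huv (a := -a) (by linarith) h2 (by linarith)
  wlog he : 0 ≤ e
  · exact this n ih hvn huv h1 (e := -e) (by linarith) ha (by linarith)
  by_contra hv
  have hv2 : 2 ∣ v := by
    by_contra hv2
    obtain ⟨i, hi⟩ := Int.eight_dvd_sq_sub_one hv2
    have hu2 : ¬ 2 ∣ u := by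
      rintro ⟨k, rfl⟩
      have : ¬ 2 ∣ e := by
        rintro ⟨l, rfl⟩
        ring_nf at h2 hi
        omega
      obtain ⟨j, hj⟩ := Int.eight_dvd_sq_sub_one this
      ring_nf at h2 hi hj
      omega
    obtain ⟨j, hj⟩ := Int.eight_dvd_sq_sub_one hu2
    have : 2 ∣ a := by
      by_contra h
      obtain ⟨k, hk⟩ := Int.eight_dvd_sq_sub_one h
      omega
    obtain ⟨k, rfl⟩ := this
    ring_nf at h1 hi hj
    omega
  obtain ⟨v, rfl⟩ := hv2
  have hu2 : ¬ 2 ∣ u := fun h => by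
    have := huv.isUnit_of_dvd' h (Dvd.intro _ rfl)
    rw [Int.isUnit_iff] at this
    omega
  have hpar : ∀ {x c : ℤ}, x ^ 2 = u ^ 2 + 4 * c → ¬ 2 ∣ x := by
    rintro x c hx ⟨k, rfl⟩
    obtain ⟨i, hi⟩ := Int.eight_dvd_sq_sub_one hu2
    ring_nf at hx hi
    omega
  have ha2 : ¬ 2 ∣ a := hpar (c := v ^ 2) (by linarith)
  have he2 : ¬ 2 ∣ e := hpar (c := -v ^ 2) (by linarith)
  -- With `v` now half of the original, `P, R = (a ± e)/2` are the legs of a Pythagorean triangle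
  -- with hypotenuse `u`, and `PR = 2v²`.
  obtain ⟨P, hP⟩ : 2 ∣ a + e := by omega
  obtain ⟨R, hR⟩ : 2 ∣ a - e := by omega
  obtain rfl : a = P + R := by omega
  obtain rfl : e = P - R := by omega
  clear hP hR hpar
  have hPR : P * R = 2 * v ^ 2 := by nlinarith
  have hPR2 : P ^ 2 + R ^ 2 = u ^ 2 := by nlinarith
  have hcop : IsCoprime P R := by
    refine Int.isCoprime_of_forall_prime fun p hp h3 h4 => ?_
    have hu : p ∣ u := hp.dvd_of_dvd_pow (n := 2)
      (hPR2 ▸ dvd_add (dvd_pow h3 two_ne_zero) (dvd_pow h4 two_ne_zero))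
    exact huv.false_of_prime_dvd hp hu
      ((hp.dvd_or_dvd ((hPR ▸ h3.mul_right R : p ∣ 2 * v ^ 2))).elim (fun h => h.mul_right v)
        fun h => (hp.dvd_of_dvd_pow h).mul_left 2)
  clear h1 h2 ha he
  wlog hP2 : 2 ∣ P generalizing P R
  · refine this (P := R) (R := P) (by rwa [add_comm]) ?_ (by linarith) (by linarith) hcop.symm ?_
    · omega
    · exact (Int.prime_two.dvd_or_dvd (hPR ▸ Dvd.intro _ rfl : 2 ∣ P * R)).resolve_left hP2
  obtain ⟨P, rfl⟩ := hP2
  have hPR' : P * R = v ^ 2 := by linarith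
  have hv0 : v ≠ 0 := by rintro rfl; simp at hv
  have hcop' : IsCoprime P R := hcop.of_mul_left_right
  obtain ⟨x, y, hxy⟩ := Int.exists_pow_of_isCoprime_mul even_two hcop' hPR'
  have hvxy : v ^ 2 = x ^ 2 * y ^ 2 := by
    rcases hxy with ⟨rfl, rfl⟩ | ⟨rfl, rfl⟩ <;> linarith
  have hu4 : u ^ 2 = 4 * x ^ 4 + y ^ 4 := by
    rcases hxy with ⟨rfl, rfl⟩ | ⟨rfl, rfl⟩ <;> linarith
  have hx0 : x ≠ 0 := by rintro rfl; simp at hvxy; exact hv0 hvxy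
  have hy0 : y ≠ 0 := by rintro rfl; simp at hvxy; exact hv0 hvxy
  have hxycop : IsCoprime x y := by
    rcases hxy with ⟨rfl, rfl⟩ | ⟨rfl, rfl⟩
    · rwa [IsCoprime.pow_iff two_pos two_pos] at hcop'
    · rwa [IsCoprime.neg_neg_iff, IsCoprime.pow_iff two_pos two_pos] at hcop'
  have huv' : IsCoprime u v := huv.of_mul_right_right
  clear hxy hcop hcop' hPR hPR' hPR2 ha2 he2 huv
  wlog hu0 : 0 ≤ u generalizing u
  · exact this (u := -u) (by omega) (by linarith) huv'.neg_left (by linarith)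
  have hyodd : ¬ 2 ∣ y := by
    rintro ⟨k, rfl⟩
    have : 2 ∣ u := Int.prime_two.dvd_of_dvd_pow (n := 2) ⟨2 * x ^ 4 + 8 * k ^ 4, by rw [hu4]; ring⟩
    exact hu2 this
  obtain ⟨i, hi⟩ := Int.eight_dvd_sq_sub_one hyodd
  obtain ⟨c, hc⟩ : 2 ∣ u - y ^ 2 := by omega
  obtain ⟨d, hd⟩ : 2 ∣ u + y ^ 2 := by omega
  -- From `u² = (2x²)² + (y²)²`: the coprime factors `(u ∓ y²)/2` of `x⁴` are fourth powers `h⁴`,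
  -- `g⁴`, and `g⁴ - h⁴ = y²`. So `g² ± h²` are squares, and `(g, h)` is the smaller solution.
  have hcd : c * d = x ^ 4 := by
    have : (u - y ^ 2) * (u + y ^ 2) = 4 * x ^ 4 := by linear_combination hu4
    rw [hc, hd] at this
    linarith
  have hcdc : IsCoprime c d := by
    refine Int.isCoprime_of_forall_prime fun p hp h3 h4 => ?_
    have hx : p ∣ x := hp.dvd_of_dvd_pow (n := 4) (hcd ▸ h3.mul_right d)
    have hy : p ∣ y := hp.dvd_of_dvd_pow (n := 2) (by
      have : y ^ 2 = d - c := by linarith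
      exact this ▸ dvd_sub h4 h3)
    exact hxycop.false_of_prime_dvd hp hx hy
  have hcd0 : 0 ≤ c ∧ 0 ≤ d := by
    have h3 : 0 < c * d := by rw [hcd]; positivity
    have h4 : 0 ≤ c + d := by linarith
    constructor <;> by_contra h5 <;> nlinarith
  obtain ⟨h, g, rfl, rfl⟩ := Int.exists_pow_of_isCoprime_mul_of_nonneg (by decide) hcdc hcd
    hcd0.1 hcd0.2
  rw [IsCoprime.pow_iff four_pos four_pos] at hcdc
  have hprod : (g ^ 2 + h ^ 2) * (g ^ 2 - h ^ 2) = y ^ 2 := by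
    have : (g ^ 2 + h ^ 2) * (g ^ 2 - h ^ 2) = g ^ 4 - h ^ 4 := by ring
    linarith
  have hgh : IsCoprime (g ^ 2 + h ^ 2) (g ^ 2 - h ^ 2) := by
    refine Int.isCoprime_of_forall_prime fun p hp h3 h4 => ?_
    have h5 : p ∣ 2 * g ^ 2 := by simpa [two_mul] using dvd_add h3 h4
    have h6 : p ∣ 2 * h ^ 2 := by
      have := dvd_sub h3 h4
      rwa [show g ^ 2 + h ^ 2 - (g ^ 2 - h ^ 2) = 2 * h ^ 2 by ring] at this
    have h7 : ¬ p ∣ 2 := fun h8 => by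
      have hy : p ∣ y ^ 2 := hprod ▸ h3.mul_right _
      exact hp.not_isUnit (isUnit_of_dvd_one
        ((Int.dvd_add_right (h8.mul_right (4 * i))).1 (by
          rwa [show 2 * (4 * i) + 1 = y ^ 2 by linarith])))
    exact hcdc.false_of_prime_dvd hp (hp.dvd_of_dvd_pow ((hp.dvd_or_dvd h6).resolve_left h7))
      (hp.dvd_of_dvd_pow ((hp.dvd_or_dvd h5).resolve_left h7))
  have hxgh : x ^ 2 = h ^ 2 * g ^ 2 := by
    have : (x ^ 2) ^ 2 = (h ^ 2 * g ^ 2) ^ 2 := by linear_combination -hcd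
    exact (sq_eq_sq₀ (by positivity) (by positivity)).1 this
  have hh0 : h ≠ 0 := by rintro rfl; simp at hxgh; exact hx0 hxgh
  have hg0 : g ≠ 0 := by rintro rfl; simp at hxgh; exact hx0 hxgh
  obtain ⟨A, B, ⟨hA, hB⟩ | ⟨hA, hB⟩⟩ := Int.exists_pow_of_isCoprime_mul even_two hgh hprod
  · refine hh0 (ih h.natAbs ?_ rfl hcdc.symm hA hB)
    rw [← hvn, Int.natAbs_lt_iff_sq_lt]
    have h1 : 0 < h ^ 2 := by positivity
    have h2 : 0 < g ^ 2 := by positivity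
    have h3 : 0 < y ^ 2 := by positivity
    have h4 : h ^ 2 ≤ v ^ 2 := by
      rw [hvxy, hxgh]
      nlinarith [mul_pos h2 h3, mul_pos h1 h2]
    have h5 : 0 < v ^ 2 := by positivity
    nlinarith
  · have h1 : 0 < h ^ 2 := by positivity
    nlinarith [sq_nonneg g, sq_nonneg A]

theorem Int.exists_nonneg_sq_eq (a : ℤ) : ∃ b, 0 ≤ b ∧ a ^ 2 = b ^ 2 :=
  ⟨|a|, abs_nonneg a, (sq_abs a).symm⟩

theorem Int.nonneg_of_add_nonneg_of_mul_pos {c d : ℤ} (h : 0 ≤ c + d) (h' : 0 < c * d) :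
    0 ≤ c ∧ 0 ≤ d := by
  constructor <;> by_contra h5 <;> nlinarith

theorem Int.two_dvd_or_sq_eq (s : ℤ) : (∃ k, s = 2 * k) ∨ ∃ i, s ^ 2 = 8 * i + 1 := by
  by_cases h : 2 ∣ s
  · exact .inl h
  · exact .inr (Int.eight_dvd_sq_sub_one h)

/-- Euler: `x⁴ + x²y² + y⁴` is a square only if `xy = 0`. -/
theorem Int.mul_eq_zero_of_pow_four_add (n : ℕ) : ∀ {x y z : ℤ}, (x * y).natAbs = n →
    IsCoprime x y → x ^ 4 + x ^ 2 * y ^ 2 + y ^ 4 = z ^ 2 → x * y = 0 := by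
  induction n using Nat.strong_induction_on with
  | _ n ih =>
  intro x y z hn hxy h
  by_contra h0
  wlog hy2 : 2 ∣ y generalizing x y
  · refine this (x := y) (y := x) (by rwa [mul_comm]) hxy.symm (by linarith) (by rwa [mul_comm]) ?_
    by_contra hx2
    obtain ⟨i, hi⟩ := Int.eight_dvd_sq_sub_one hy2
    obtain ⟨j, hj⟩ := Int.eight_dvd_sq_sub_one hx2
    rw [show x ^ 4 = (x ^ 2) ^ 2 by ring, show y ^ 4 = (y ^ 2) ^ 2 by ring, hi, hj] at h
    rcases z.two_dvd_or_sq_eq with ⟨k, rfl⟩ | ⟨k, hk⟩ <;> ring_nf at * <;> omega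
  obtain ⟨y, rfl⟩ := hy2
  have hx2 : ¬ 2 ∣ x := fun h => hxy.false_of_prime_dvd Int.prime_two h (Dvd.intro _ rfl)
  have hxy' : IsCoprime x y := hxy.of_mul_right_right
  have hx0 : x ≠ 0 := by rintro rfl; simp at h0
  have hy0 : y ≠ 0 := by rintro rfl; simp at h0
  obtain ⟨i, hi⟩ := Int.eight_dvd_sq_sub_one hx2
  obtain ⟨z, hz0, hz⟩ := z.exists_nonneg_sq_eq
  rw [hz] at h
  clear hz
  have hz2 : ¬ 2 ∣ z := by
    rintro ⟨k, rfl⟩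
    rw [show x ^ 4 = (x ^ 2) ^ 2 by ring, hi] at h
    ring_nf at h
    omega
  obtain ⟨c, hc⟩ : 2 ∣ z - (x ^ 2 + 2 * y ^ 2) := by omega
  obtain ⟨d, hd⟩ : 2 ∣ z + (x ^ 2 + 2 * y ^ 2) := by omega
  -- Completing the square with `y` halved: `z² - (x² + 2y²)² = 12y⁴`. Up to the factor 3, `c` and
  -- `d` are coprime, hence fourth powers.
  have hcd : c * d = 3 * y ^ 4 := by
    have : (z - (x ^ 2 + 2 * y ^ 2)) * (z + (x ^ 2 + 2 * y ^ 2)) = 12 * y ^ 4 := by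
      linear_combination -h
    rw [hc, hd] at this
    linarith
  have hsub : x ^ 2 = d - c - 2 * y ^ 2 := by linarith
  obtain ⟨hc0, hd0⟩ := Int.nonneg_of_add_nonneg_of_mul_pos (by linarith)
    (by rw [hcd]; positivity : 0 < c * d)
  have hcop : ∀ {p : ℤ}, Prime p → p ∣ c → p ∣ d → p ∣ y → False := fun {p} hp h1 h2 h3 =>
    hxy'.false_of_prime_dvd hp (hp.dvd_of_dvd_pow (n := 2) (hsub ▸ dvd_sub (dvd_sub h2 h1)
      ((dvd_pow h3 two_ne_zero).mul_left _))) h3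
  rcases Int.prime_three.dvd_or_dvd (hcd ▸ Dvd.intro _ rfl : (3 : ℤ) ∣ c * d) with h3 | h3
  · obtain ⟨c, rfl⟩ := h3
    have hcd' : c * d = y ^ 4 := by linarith
    have hcop' : IsCoprime c d := Int.isCoprime_of_forall_prime fun p hp h1 h2 =>
      hcop hp (h1.mul_left 3) h2 (hp.dvd_of_dvd_pow (hcd' ▸ h1.mul_right d))
    obtain ⟨e, f, rfl, rfl⟩ := Int.exists_pow_of_isCoprime_mul_of_nonneg (by decide) hcop' hcd'
      (by linarith) hd0
    rw [IsCoprime.pow_iff four_pos four_pos] at hcop'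
    have hy : y ^ 2 = e ^ 2 * f ^ 2 := by
      refine (sq_eq_sq₀ (by positivity) (by positivity)).1 ?_
      linear_combination -hcd'
    have hx : (f ^ 2 + e ^ 2) * (f ^ 2 - 3 * e ^ 2) = x ^ 2 := by rw [hsub, hy]; ring
    have hcop2 : IsCoprime (f ^ 2 + e ^ 2) (f ^ 2 - 3 * e ^ 2) := by
      refine Int.isCoprime_of_forall_prime fun p hp h1 h2 => ?_
      have hp2 : ¬ p ∣ 4 := fun h => hp.not_isUnit (isUnit_of_dvd_one <| by
        have h6 : p ∣ x ^ 2 := hx ▸ h1.mul_right _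
        have h7 : p ∣ 2 := hp.dvd_of_dvd_pow (n := 2) (by simpa using h)
        have h8 := dvd_sub h6 (h7.mul_right (4 * i))
        rwa [show x ^ 2 - 2 * (4 * i) = 1 by linarith] at h8)
      have h3 : p ∣ 4 * e ^ 2 := by
        have := dvd_sub h1 h2
        rwa [show f ^ 2 + e ^ 2 - (f ^ 2 - 3 * e ^ 2) = 4 * e ^ 2 by ring] at this
      have h4 : p ∣ e := hp.dvd_of_dvd_pow ((hp.dvd_or_dvd h3).resolve_left hp2)
      have h5 : p ∣ f := hp.dvd_of_dvd_pow (n := 2)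
        ((Int.dvd_add_left (dvd_pow h4 two_ne_zero)).1 h1)
      exact hcop'.false_of_prime_dvd hp h4 h5
    have he0 : e ≠ 0 := by rintro rfl; simp at hy; exact hy0 hy
    have hf0 : f ≠ 0 := by rintro rfl; simp at hy; exact hy0 hy
    obtain ⟨g, k, ⟨hg, hk⟩ | ⟨hg, -⟩⟩ := Int.exists_pow_of_isCoprime_mul even_two hcop2 hx
    swap
    · have : 0 < e ^ 2 := by positivity
      nlinarith [sq_nonneg f, sq_nonneg g]
    obtain ⟨g, hg0, hg'⟩ := g.exists_nonneg_sq_eq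
    rw [hg'] at hg
    clear hg'
    have hodd : ¬ 2 ∣ g ∧ ¬ 2 ∣ k := by
      have h9 : g ^ 2 * k ^ 2 = x ^ 2 := by rw [← hg, ← hk, hx]
      constructor <;> rintro ⟨l, rfl⟩ <;> rw [hi] at h9 <;> ring_nf at h9 <;> omega
    obtain ⟨r, hr⟩ : 2 ∣ g - k := by omega
    obtain ⟨s, hs⟩ : 2 ∣ g + k := by omega
    obtain rfl : g = r + s := by linarith
    obtain rfl : k = s - r := by linarith
    have hrs : r * s = e ^ 2 := by linarith
    have hcop3 : IsCoprime r s := by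
      refine Int.isCoprime_of_forall_prime fun p hp h1 h2 => ?_
      have h3 : p ∣ e := hp.dvd_of_dvd_pow (n := 2) (hrs ▸ h1.mul_right s)
      have h4 : p ∣ f := hp.dvd_of_dvd_pow (n := 2) (by
        rw [show f ^ 2 = (r + s) * (r + s) - e * e by linarith]
        exact dvd_sub ((dvd_add h1 h2).mul_right _) (h3.mul_right _))
      exact hcop'.false_of_prime_dvd hp h3 h4
    obtain ⟨hr0, hs0⟩ := Int.nonneg_of_add_nonneg_of_mul_pos hg0
      (by rw [hrs]; positivity : 0 < r * s)
    obtain ⟨p, q, rfl, rfl⟩ := Int.exists_pow_of_isCoprime_mul_of_nonneg even_two hcop3 hrs hr0 hs0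
    rw [IsCoprime.pow_iff two_pos two_pos] at hcop3
    -- Here `f² + e² = (p² + q²)²` and `e² = p²q²`, so `(p, q, f)` solves the original equation.
    have hpq : p * q = 0 := by
      refine ih (p * q).natAbs ?_ rfl hcop3 (z := f) (by linear_combination -hg - hrs)
      rw [← hn, Int.natAbs_lt_iff_sq_lt, mul_pow, hrs, mul_pow, mul_pow, hy]
      have h1 : 0 < e ^ 2 := by positivity
      have h2 : 0 < f ^ 2 := by positivity
      have h3 : 0 < x ^ 2 := by positivity
      nlinarith [mul_pos h1 h2, mul_pos h3 (mul_pos h1 h2)]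
    have : e ^ 2 = 0 := by rw [← hrs, ← mul_pow, hpq]; simp
    exact he0 (by simpa using this)
  · obtain ⟨d, rfl⟩ := h3
    have hcd' : c * d = y ^ 4 := by linarith
    have hcop' : IsCoprime c d := Int.isCoprime_of_forall_prime fun p hp h1 h2 =>
      hcop hp h1 (h2.mul_left 3) (hp.dvd_of_dvd_pow (hcd' ▸ h1.mul_right d))
    obtain ⟨e, f, rfl, rfl⟩ := Int.exists_pow_of_isCoprime_mul_of_nonneg (by decide) hcop' hcd'
      hc0 (by linarith)
    have hy : y ^ 2 = e ^ 2 * f ^ 2 := by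
      refine (sq_eq_sq₀ (by positivity) (by positivity)).1 ?_
      linear_combination -hcd'
    -- If 3 divides `d` instead, `x² = 3f⁴ - e⁴ - 2e²f²`, which is never 1 modulo 8.
    rw [hy, hi, show e ^ 4 = (e ^ 2) ^ 2 by ring, show f ^ 4 = (f ^ 2) ^ 2 by ring] at hsub
    clear! x y z
    rcases e.two_dvd_or_sq_eq with ⟨k, rfl⟩ | ⟨k, hk⟩ <;>
      rcases f.two_dvd_or_sq_eq with ⟨l, rfl⟩ | ⟨l, hl⟩ <;>
      (try simp only [hk] at hsub) <;> (try simp only [hl] at hsub) <;> ring_nf at hsub <;> omega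

/-- `a⁴ - 2a²b² + 4b⁴` is not a square for coprime `a`, `b` with `a` odd and `b ≠ 0`. -/
theorem Int.eq_zero_of_pow_four_sub_two_mul (n : ℕ) : ∀ {a b D : ℤ}, b.natAbs = n →
    IsCoprime a b → ¬ 2 ∣ a → a ^ 4 - 2 * a ^ 2 * b ^ 2 + 4 * b ^ 4 = D ^ 2 → b = 0 := by
  induction n using Nat.strong_induction_on with
  | _ n ih =>
  intro a b D hn hab ha2 h
  by_contra h0
  obtain ⟨i, hi⟩ := Int.eight_dvd_sq_sub_one ha2
  have hb2 : 2 ∣ b := by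
    by_contra hb2
    obtain ⟨j, hj⟩ := Int.eight_dvd_sq_sub_one hb2
    rw [show a ^ 4 = (a ^ 2) ^ 2 by ring, show b ^ 4 = (b ^ 2) ^ 2 by ring, hi, hj] at h
    rcases D.two_dvd_or_sq_eq with ⟨k, rfl⟩ | ⟨k, hk⟩ <;> ring_nf at * <;> omega
  obtain ⟨b, rfl⟩ := hb2
  have hab' : IsCoprime a b := hab.of_mul_right_right
  have hb0 : b ≠ 0 := by rintro rfl; simp at h0
  obtain ⟨D, hD0, hD⟩ := D.exists_nonneg_sq_eq
  rw [hD] at h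
  clear hD
  have hD2 : ¬ 2 ∣ D := by
    rintro ⟨k, rfl⟩
    rw [show a ^ 4 = (a ^ 2) ^ 2 by ring, hi] at h
    ring_nf at h
    omega
  obtain ⟨c, hc⟩ : 2 ∣ D - (a ^ 2 - 4 * b ^ 2) := by omega
  obtain ⟨d, hd⟩ : 2 ∣ D + (a ^ 2 - 4 * b ^ 2) := by omega
  -- Completing the square with `b` halved: `D² - (a² - 4b²)² = 48b⁴`.
  have hcd : c * d = 12 * b ^ 4 := by
    have : (D - (a ^ 2 - 4 * b ^ 2)) * (D + (a ^ 2 - 4 * b ^ 2)) = 48 * b ^ 4 := by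
      linear_combination -h
    rw [hc, hd] at this
    linarith
  have hcdD : c + d = D := by linarith
  have hsub : a ^ 2 = d - c + 4 * b ^ 2 := by linarith
  obtain ⟨hc0, hd0⟩ := Int.nonneg_of_add_nonneg_of_mul_pos (by linarith)
    (by rw [hcd]; positivity : 0 < c * d)
  clear hc hd h
  have key : ∀ {c' d' k l : ℤ}, c = k * c' → d = l * d' → 0 < k → 0 < l → k * l = 12 →
      ∃ e f : ℤ, IsCoprime e f ∧ b ^ 2 = e ^ 2 * f ^ 2 ∧
        a ^ 2 = l * f ^ 4 - k * e ^ 4 + 4 * (e ^ 2 * f ^ 2) := by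
    rintro c' d' k l rfl rfl hk hl hkl
    have hcd' : c' * d' = b ^ 4 := by
      have : 12 * (c' * d') = 12 * b ^ 4 := by rw [← hcd, ← hkl]; ring
      linarith
    have hcop' : IsCoprime c' d' := Int.isCoprime_of_forall_prime fun p hp h1 h2 => by
      have h3 : p ∣ b := hp.dvd_of_dvd_pow (hcd' ▸ h1.mul_right d')
      exact hab'.false_of_prime_dvd hp (hp.dvd_of_dvd_pow (n := 2) (hsub ▸ dvd_add
        (dvd_sub (h2.mul_left l) (h1.mul_left k)) ((dvd_pow h3 two_ne_zero).mul_left _))) h3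
    obtain ⟨e, f, rfl, rfl⟩ := Int.exists_pow_of_isCoprime_mul_of_nonneg (by decide) hcop' hcd'
      (nonneg_of_mul_nonneg_right hc0 hk) (nonneg_of_mul_nonneg_right hd0 hl)
    rw [IsCoprime.pow_iff four_pos four_pos] at hcop'
    have hb : b ^ 2 = e ^ 2 * f ^ 2 := by
      refine (sq_eq_sq₀ (by positivity) (by positivity)).1 ?_
      linear_combination -hcd'
    exact ⟨e, f, hcop', hb, by rw [hsub, hb]⟩
  -- Of the four ways to share 4 and 3 between `c` and `d`, these three contradict `a² ≡ 1` modulo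
  -- 8. Only `c = 12e⁴`, `d = f⁴` survives.
  have hmod : ∀ {k l e f : ℤ}, (k = 4 ∧ l = 3 ∨ k = 3 ∧ l = 4 ∨ k = 1 ∧ l = 12) →
      a ^ 2 = l * f ^ 4 - k * e ^ 4 + 4 * (e ^ 2 * f ^ 2) → False := by
    intro k l e f hkl h
    rw [hi, show e ^ 4 = (e ^ 2) ^ 2 by ring, show f ^ 4 = (f ^ 2) ^ 2 by ring] at h
    clear! a b
    rcases hkl with ⟨rfl, rfl⟩ | ⟨rfl, rfl⟩ | ⟨rfl, rfl⟩ <;>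
    rcases e.two_dvd_or_sq_eq with ⟨k, rfl⟩ | ⟨k, hk⟩ <;>
      rcases f.two_dvd_or_sq_eq with ⟨l, rfl⟩ | ⟨l, hl⟩ <;>
      (try simp only [hk] at h) <;> (try simp only [hl] at h) <;> ring_nf at h <;> omega
  -- Since `c + d = D` is odd, one factor absorbs the whole power of two.
  have h4 : 4 ∣ c ∨ 4 ∣ d := by
    have h4 : 4 ∣ c * d := ⟨3 * b ^ 4, by rw [hcd]; ring⟩
    have hodd : ∀ {x : ℤ}, ¬ 2 ∣ x → IsCoprime 4 x := fun {x} hx => by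
      have : IsCoprime ((2 : ℤ) ^ 2) x := ((Int.prime_two.coprime_iff_not_dvd).2 hx).pow_left
      simpa using this
    by_cases hc2 : 2 ∣ c
    · exact .inl ((hodd (by omega : ¬ 2 ∣ d)).dvd_of_dvd_mul_right h4)
    · exact .inr ((hodd hc2).dvd_of_dvd_mul_left h4)
  have h3 : 3 ∣ c ∨ 3 ∣ d :=
    Int.prime_three.dvd_or_dvd ⟨4 * b ^ 4, by rw [hcd]; ring⟩
  rcases h4 with h4 | h4 <;> rcases h3 with h3 | h3
  · obtain ⟨c', hc'⟩ : 12 ∣ c := by omega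
    obtain ⟨e, f, hef, hb, ha⟩ := key hc' (one_mul d).symm (by norm_num) (by norm_num) (by norm_num)
    have he0 : e ≠ 0 := by rintro rfl; simp at hb; exact hb0 hb
    have hf0 : f ≠ 0 := by rintro rfl; simp at hb; exact hb0 hb
    have ha' : (f ^ 2 + 6 * e ^ 2) * (f ^ 2 - 2 * e ^ 2) = a ^ 2 := by rw [ha]; ring
    have hcop2 : IsCoprime (f ^ 2 + 6 * e ^ 2) (f ^ 2 - 2 * e ^ 2) := by
      refine Int.isCoprime_of_forall_prime fun p hp h1 h2 => ?_
      have hp2 : ¬ p ∣ 2 := fun h => hp.not_isUnit (isUnit_of_dvd_one <| by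
        have h6 : p ∣ a ^ 2 := ha' ▸ h1.mul_right _
        have h8 := dvd_sub h6 (h.mul_right (4 * i))
        rwa [show a ^ 2 - 2 * (4 * i) = 1 by linarith] at h8)
      have h3 : p ∣ 2 ^ 3 * e ^ 2 := by
        have := dvd_sub h1 h2
        rwa [show f ^ 2 + 6 * e ^ 2 - (f ^ 2 - 2 * e ^ 2) = 2 ^ 3 * e ^ 2 by ring] at this
      have h4 : p ∣ e := hp.dvd_of_dvd_pow ((hp.dvd_or_dvd h3).resolve_left
        fun h => hp2 (hp.dvd_of_dvd_pow h))
      have h5 : p ∣ f := hp.dvd_of_dvd_pow (n := 2)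
        ((Int.dvd_add_left ((dvd_pow h4 two_ne_zero).mul_left 6)).1 h1)
      exact hef.false_of_prime_dvd hp h4 h5
    obtain ⟨g, k, ⟨hg, hk⟩ | ⟨hg, -⟩⟩ := Int.exists_pow_of_isCoprime_mul even_two hcop2 ha'
    swap
    · have : 0 < e ^ 2 := by positivity
      nlinarith [sq_nonneg f, sq_nonneg g]
    obtain ⟨g, hg0, hg'⟩ := g.exists_nonneg_sq_eq
    rw [hg'] at hg
    clear hg'
    have hodd : ¬ 2 ∣ g ∧ ¬ 2 ∣ k := by
      have h9 : g ^ 2 * k ^ 2 = a ^ 2 := by rw [← hg, ← hk, ha']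
      constructor <;> rintro ⟨l, rfl⟩ <;> rw [hi] at h9 <;> ring_nf at h9 <;> omega
    have he2 : 2 ∣ e := by
      by_contra he2
      obtain ⟨l, hl⟩ := Int.eight_dvd_sq_sub_one he2
      obtain ⟨m, hm⟩ := Int.eight_dvd_sq_sub_one hodd.2
      rcases f.two_dvd_or_sq_eq with ⟨o, rfl⟩ | ⟨o, ho⟩ <;> ring_nf at * <;> omega
    obtain ⟨e, rfl⟩ := he2
    obtain ⟨r, hr⟩ : 2 ∣ g - k := by omega
    obtain ⟨s, hs⟩ : 2 ∣ g + k := by omega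
    obtain rfl : g = r + s := by linarith
    obtain rfl : k = s - r := by linarith
    have hrs : r * s = 8 * e ^ 2 := by linarith
    have hf : f ^ 2 = (s - r) * (s - r) + 8 * (e * e) := by linarith
    obtain ⟨hr0, hs0⟩ := Int.nonneg_of_add_nonneg_of_mul_pos hg0
      (by rw [hrs]; simp at he0; positivity : 0 < r * s)
    have key2 : ∀ {r' s' k l : ℤ}, r = k * r' → s = l * s' → 0 < k → 0 < l → k * l = 8 →
        ∃ p q : ℤ, IsCoprime p q ∧ e ^ 2 = p ^ 2 * q ^ 2 ∧ r = k * p ^ 2 ∧ s = l * q ^ 2 := by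
      rintro r' s' k l rfl rfl hk hl hkl
      have hrs' : r' * s' = e ^ 2 := by
        have : 8 * (r' * s') = 8 * e ^ 2 := by rw [← hrs, ← hkl]; ring
        linarith
      have hcop3 : IsCoprime r' s' := Int.isCoprime_of_forall_prime fun p hp h1 h2 => by
        have h3 : p ∣ e := hp.dvd_of_dvd_pow (hrs' ▸ h1.mul_right s')
        exact hef.false_of_prime_dvd hp (h3.mul_left 2) (hp.dvd_of_dvd_pow (n := 2) (hf ▸ dvd_add
          ((dvd_sub (h2.mul_left l) (h1.mul_left k)).mul_right _) ((h3.mul_right e).mul_left _)))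
      obtain ⟨p, q, rfl, rfl⟩ := Int.exists_pow_of_isCoprime_mul_of_nonneg even_two hcop3 hrs'
        (nonneg_of_mul_nonneg_right hr0 hk) (nonneg_of_mul_nonneg_right hs0 hl)
      rw [IsCoprime.pow_iff two_pos two_pos] at hcop3
      exact ⟨p, q, hcop3, hrs'.symm, rfl, rfl⟩
    -- The right side is `p⁴ - 2p²(2q)² + 4(2q)⁴`, so `(p, 2q)` is a smaller solution.
    have final : ∀ {p q : ℤ}, IsCoprime p q → e ^ 2 = p ^ 2 * q ^ 2 → ¬ 2 ∣ p →
        f ^ 2 = (p ^ 2 - 8 * q ^ 2) ^ 2 + 8 * (p ^ 2 * q ^ 2) → False := by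
      intro p q hpq he hp2 hf'
      have hq : 2 * q = 0 := by
        refine ih (2 * q).natAbs ?_ rfl (IsCoprime.mul_right
          ((Int.prime_two.coprime_iff_not_dvd).2 hp2).symm hpq) hp2 (D := f)
          (by linear_combination -hf')
        rw [← hn, Int.natAbs_lt_iff_sq_lt, mul_pow, mul_pow 2 b, hb, mul_pow, he]
        have h1 : 0 < f ^ 2 := by positivity
        have h2 : 0 < p ^ 2 * q ^ 2 := by rw [← he]; simp at he0; positivity
        have h3 : 0 < q ^ 2 := pos_of_mul_pos_right h2 (sq_nonneg p)
        have h4 : 0 < p ^ 2 := pos_of_mul_pos_left h2 (sq_nonneg q)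
        nlinarith [mul_pos h2 h1, mul_pos h3 h4]
      obtain rfl : q = 0 := by linarith
      simp at he he0
      exact he0 he
    have h8 : 8 ∣ r * s := ⟨e ^ 2, hrs⟩
    have hodd8 : ∀ {x : ℤ}, ¬ 2 ∣ x → IsCoprime 8 x := fun {x} hx => by
      have : IsCoprime ((2 : ℤ) ^ 3) x := ((Int.prime_two.coprime_iff_not_dvd).2 hx).pow_left
      simpa using this
    by_cases hr2 : 2 ∣ r
    · obtain ⟨r', hr'⟩ := (hodd8 (by omega : ¬ 2 ∣ s)).dvd_of_dvd_mul_right h8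
      obtain ⟨p, q, hpq, he, hr'', hs''⟩ := key2 hr' (one_mul s).symm (by norm_num) (by norm_num)
        (by norm_num)
      refine final hpq.symm (by rw [he, mul_comm]) ?_ (by rw [hf, ← sq e, he, hr'', hs'']; ring)
      rintro ⟨l, rfl⟩
      have : 2 ∣ s := ⟨2 * l ^ 2, by rw [hs'']; ring⟩
      omega
    · obtain ⟨s', hs'⟩ := (hodd8 hr2).dvd_of_dvd_mul_left h8
      obtain ⟨p, q, hpq, he, hr'', hs''⟩ := key2 (one_mul r).symm hs' (by norm_num) (by norm_num)
        (by norm_num)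
      refine final hpq he ?_ (by rw [hf, ← sq e, he, hr'', hs'']; ring)
      rintro ⟨l, rfl⟩
      exact hr2 ⟨2 * l ^ 2, by rw [hr'']; ring⟩
  · obtain ⟨c', hc'⟩ := h4
    obtain ⟨d', hd'⟩ := h3
    obtain ⟨e, f, -, -, ha⟩ := key hc' hd' (by norm_num) (by norm_num) (by norm_num)
    exact hmod (by simp) ha
  · obtain ⟨c', hc'⟩ := h3
    obtain ⟨d', hd'⟩ := h4
    obtain ⟨e, f, -, -, ha⟩ := key hc' hd' (by norm_num) (by norm_num) (by norm_num)
    exact hmod (by simp) ha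
  · obtain ⟨d', hd'⟩ : 12 ∣ d := by omega
    obtain ⟨e, f, -, -, ha⟩ := key (one_mul c).symm hd' (by norm_num) (by norm_num) (by norm_num)
    exact hmod (by simp) ha

/-! ### Halving quartics on `E_m`. -/

/-- This and the next two quartics belong to `(0, k)`, `(1, k)` and `(-1, -k)` on `y² = x³ - x +
k²`, used with `k = m³`. The first fails modulo 16 or by parity; in the other two the constant term
1 forces `s = ±1`. -/
theorem pow_four_sub_ne_zero (k s : ℤ) : s ^ 4 - 8 * k * s + 4 ≠ 0 := by
  intro h
  rcases s.two_dvd_or_sq_eq with ⟨l, rfl⟩ | ⟨i, hi⟩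
  · ring_nf at h
    omega
  · rw [show s ^ 4 = (s ^ 2) ^ 2 by ring, hi] at h
    ring_nf at h
    omega

theorem pow_four_sub_six_mul_ne_zero (k s : ℤ) : s ^ 4 - 6 * s ^ 2 - 8 * k * s + 1 ≠ 0 := by
  intro h
  have hs : IsUnit s := isUnit_of_dvd_one ⟨-(s ^ 3 - 6 * s - 8 * k), by linear_combination h⟩
  rcases Int.isUnit_iff.1 hs with rfl | rfl <;> omega

theorem sq_eq_one_of_pow_four_add_six_mul {k s : ℤ} (h : s ^ 4 + 6 * s ^ 2 + 8 * k * s + 1 = 0) :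
    k ^ 2 = 1 := by
  have hs : IsUnit s := isUnit_of_dvd_one ⟨-(s ^ 3 + 6 * s + 8 * k), by linear_combination h⟩
  rcases Int.isUnit_iff.1 hs with rfl | rfl
  · obtain rfl : k = -1 := by omega
    norm_num
  · obtain rfl : k = 1 := by omega
    norm_num

theorem Int.dvd_one_of_dvd_sub {p a b : ℤ} (h : a - b = 1) (ha : p ∣ a) (hb : p ∣ b) : p ∣ 1 :=
  h ▸ dvd_sub ha hb

/-- The quartic expressing that `(-m², m)` is divisible by two in `y² = x³ - x + m⁶`. -/
theorem sq_eq_one_of_halving_neg_sq {m s : ℤ}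
    (h : s ^ 4 + 6 * m ^ 2 * s ^ 2 - 8 * m * s - 3 * m ^ 4 + 4 = 0) : m ^ 2 = 1 := by
  have hsm : 2 ∣ s + m := by
    rcases s.two_dvd_or_sq_eq with ⟨l, rfl⟩ | ⟨i, hi⟩ <;>
      rcases m.two_dvd_or_sq_eq with ⟨k, rfl⟩ | ⟨j, hj⟩
    · omega
    · rw [show m ^ 4 = (m ^ 2) ^ 2 by ring, hj] at h
      ring_nf at h
      omega
    · rw [show s ^ 4 = (s ^ 2) ^ 2 by ring, hi] at h
      ring_nf at h
      omega
    · have hs : ¬ 2 ∣ s := by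
        rintro ⟨k, rfl⟩
        ring_nf at hi
        omega
      have hm : ¬ 2 ∣ m := by
        rintro ⟨k, rfl⟩
        ring_nf at hj
        omega
      omega
  -- The substitution `s = a + b`, `m = a - b` turns the quartic into `(a² - b² - 1)² = -4ab(a² - ab
  -- + b²)`, with pairwise coprime `a`, `b`, `a² - ab + b²`.
  obtain ⟨a, ha⟩ := hsm
  obtain ⟨b, hb⟩ : 2 ∣ s - m := by omega
  obtain rfl : s = a + b := by linarith
  obtain rfl : m = a - b := by linarith
  clear ha hb
  have h1 : (a ^ 2 - b ^ 2 - 1) ^ 2 = 4 * (-(a * b) * (a ^ 2 - a * b + b ^ 2)) := by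
    have h2 : 4 * ((a ^ 2 - b ^ 2 - 1) ^ 2 - 4 * (-(a * b) * (a ^ 2 - a * b + b ^ 2))) = 0 := by
      linear_combination h
    linarith
  obtain ⟨w, hw⟩ : 2 ∣ a ^ 2 - b ^ 2 - 1 :=
    Int.prime_two.dvd_of_dvd_pow (n := 2) (h1 ▸ (by norm_num : (2 : ℤ) ∣ 4).mul_right _)
  have hw2 : -(a * b) * (a ^ 2 - a * b + b ^ 2) = w ^ 2 := by
    rw [hw] at h1
    linarith
  have hab : IsCoprime a b := by
    refine Int.isCoprime_of_forall_prime fun p hp h1 h2 => ?_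
    have h3 : p ∣ w := hp.dvd_of_dvd_pow (n := 2)
      (hw2 ▸ (dvd_neg.2 (h1.mul_right b)).mul_right _)
    refine hp.not_isUnit (isUnit_of_dvd_one (Int.dvd_one_of_dvd_sub (a := a ^ 2 - b ^ 2)
      (b := 2 * w) (by linarith) ?_ (h3.mul_left 2)))
    exact dvd_sub (dvd_pow h1 two_ne_zero) (dvd_pow h2 two_ne_zero)
  have hac : IsCoprime a (a ^ 2 - a * b + b ^ 2) := Int.isCoprime_of_forall_prime fun p hp h1 h2 =>
    hab.false_of_prime_dvd hp h1 (hp.dvd_of_dvd_pow (n := 2) ((Int.dvd_add_right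
      (dvd_sub (dvd_pow h1 two_ne_zero) (h1.mul_right b))).1 h2))
  have hbc : IsCoprime b (a ^ 2 - a * b + b ^ 2) := Int.isCoprime_of_forall_prime fun p hp h1 h2 =>
    hab.false_of_prime_dvd hp (hp.dvd_of_dvd_pow (n := 2) (by
      rw [show a ^ 2 = a ^ 2 - a * b + b ^ 2 + b * (a - b) by ring]
      exact dvd_add h2 (h1.mul_right _))) h1
  -- Otherwise `a` and `b` are squares up to opposite signs, and `a² - ab + b² = x⁴ + x²y² + y⁴` is
  -- a square, against Euler. With `ab = 0` what is left is `a² - b² = 1`.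
  have hab0 : a * b = 0 := by
    by_contra hab0
    have ha0 : a ≠ 0 := left_ne_zero_of_mul hab0
    have hb0 : b ≠ 0 := right_ne_zero_of_mul hab0
    have ha2 : 0 < a ^ 2 := by positivity
    have hb2 : 0 < b ^ 2 := by positivity
    have hc : 0 < a ^ 2 - a * b + b ^ 2 := by nlinarith [sq_nonneg (a - b)]
    have hneg : a * b < 0 := by
      by_contra h
      have : 0 < a * b := lt_of_le_of_ne (not_lt.1 h) (Ne.symm hab0)
      nlinarith [mul_pos this hc, sq_nonneg w]
    obtain ⟨x, _, hx⟩ := Int.exists_pow_of_isCoprime_mul (n := 2) (w := w) even_two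
      (hab.mul_right hac).neg_right (by linarith)
    obtain ⟨y, _, hy⟩ := Int.exists_pow_of_isCoprime_mul (n := 2) (w := w) even_two
      (hab.symm.mul_right hbc).neg_right (by linarith)
    obtain ⟨z, _, hz⟩ := Int.exists_pow_of_isCoprime_mul (n := 2) (w := w) even_two
      (hac.symm.mul_right hbc.symm).neg_right (by linarith)
    have hz' : a ^ 2 - a * b + b ^ 2 = z ^ 2 := by
      rcases hz with hz | hz
      · exact hz.1
      · nlinarith [sq_nonneg z]
    have hxy : a = x ^ 2 ∧ b = -y ^ 2 ∨ a = -x ^ 2 ∧ b = y ^ 2 := by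
      have hx0 := sq_nonneg x
      have hy0 := sq_nonneg y
      rcases hx with ⟨hx, -⟩ | ⟨hx, -⟩ <;> rcases hy with ⟨hy, -⟩ | ⟨hy, -⟩
      · nlinarith [mul_nonneg hx0 hy0]
      · exact .inl ⟨hx, hy⟩
      · exact .inr ⟨hx, hy⟩
      · nlinarith [mul_nonneg hx0 hy0]
    have hcop : IsCoprime x y := by
      rw [← IsCoprime.pow_iff two_pos two_pos (x := x) (y := y)]
      rcases hxy with ⟨rfl, rfl⟩ | ⟨rfl, rfl⟩ <;>
        simpa only [IsCoprime.neg_left_iff, IsCoprime.neg_right_iff] using hab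
    have hxy0 := Int.mul_eq_zero_of_pow_four_add _ rfl hcop (z := z) (by
      rw [← hz']
      rcases hxy with ⟨rfl, rfl⟩ | ⟨rfl, rfl⟩ <;> ring)
    have : x ^ 2 * y ^ 2 = 0 := by rw [← mul_pow, hxy0]; simp
    rcases hxy with ⟨rfl, rfl⟩ | ⟨rfl, rfl⟩ <;> nlinarith
  have hw0 : w = 0 := by
    rw [hab0] at hw2
    simpa using hw2.symm
  subst hw0
  rcases mul_eq_zero.1 hab0 with rfl | rfl
  · nlinarith [sq_nonneg b]
  · nlinarith

/-- The quartic expressing that `(2m² - 1, 3m³ - 2m)` is divisible by two in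
`y² = x³ - x + m⁶`. -/
theorem halving_two_mul_sq_sub_one_ne_zero (m s : ℤ) :
    s ^ 4 - 6 * (2 * m ^ 2 - 1) * s ^ 2 - 8 * (3 * m ^ 3 - 2 * m) * s
      - 3 * (2 * m ^ 2 - 1) ^ 2 + 4 ≠ 0 := by
  intro h
  rw [show s ^ 4 = (s ^ 2) ^ 2 by ring] at h
  rcases s.two_dvd_or_sq_eq with ⟨l, rfl⟩ | ⟨i, hi⟩ <;>
    rcases m.two_dvd_or_sq_eq with ⟨k, rfl⟩ | ⟨j, hj⟩
  · ring_nf at h; omega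
  · rw [show m ^ 3 = m ^ 2 * m by ring, hj] at h; ring_nf at h; omega
  · rw [hi] at h; ring_nf at h; omega
  · rw [hi, show m ^ 3 = m ^ 2 * m by ring, hj] at h; ring_nf at h; omega

/-- The halving quartic of `R - (P + Q)` takes this shape for `u = m - s`. Halving `u` and writing
`m² = 8i + 1` makes the right side, up to a constant, a product of three pairwise coprime factors;
being squares up to sign, they produce a solution of `A⁴ - 2A²B² + 4B⁴ = D²`. -/
theorem sq_eq_one_of_sq_add_sq_sub_one {m u : ℤ} (hm : ¬ 2 ∣ m) (hu : 2 ∣ u)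
    (h : (m ^ 2 + u ^ 2 - 1) ^ 2 = 4 * (u * (u + m) * (m * (u + m) + 1))) : m ^ 2 = 1 := by
  wlog hv0 : 0 ≤ u + m generalizing u m
  · have := this (m := -m) (u := -u) (by omega) (by omega) (by linear_combination h) (by omega)
    linarith
  obtain ⟨u, rfl⟩ := hu
  obtain ⟨i, hi⟩ := Int.eight_dvd_sq_sub_one hm
  have hn : m * (2 * u + m) + 1 = 2 * (4 * i + 1 + u * m) := by linear_combination hi
  have hw : m ^ 2 + (2 * u) ^ 2 - 1 = 4 * (2 * i + u ^ 2) := by linear_combination hi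
  have hw2 : (2 * i + u ^ 2) ^ 2 = (2 * u + m) * (u * (4 * i + 1 + u * m)) := by
    rw [hn, hw] at h
    linarith
  have hum : IsCoprime u m := by
    refine Int.isCoprime_of_forall_prime fun p hp h1 h2 => ?_
    have h3 : p ∣ 2 * i + u ^ 2 := hp.dvd_of_dvd_pow (hw2 ▸ (h1.mul_right _).mul_left _)
    have h4 : p ∣ 2 * i := (Int.dvd_add_left (dvd_pow h1 two_ne_zero)).1 h3
    exact hp.not_isUnit (isUnit_of_dvd_one (Int.dvd_one_of_dvd_sub (a := m ^ 2)
      (b := 4 * (2 * i)) (by linarith) (dvd_pow h2 two_ne_zero) (h4.mul_left 4)))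
  have huv : IsCoprime (2 * u + m) u := by
    have := hum.symm.add_mul_right_left 2
    rwa [add_comm] at this
  have hvn : IsCoprime (2 * u + m) (4 * i + 1 + u * m) := by
    refine Int.isCoprime_of_forall_prime fun p hp h1 h2 => ?_
    exact hp.not_isUnit (isUnit_of_dvd_one (Int.dvd_one_of_dvd_sub
      (a := 2 * (4 * i + 1 + u * m)) (b := m * (2 * u + m)) (by linarith)
      (h2.mul_left 2) (h1.mul_left m)))
  have hun : IsCoprime u (4 * i + 1 + u * m) := by
    refine Int.isCoprime_of_forall_prime fun p hp h1 h2 => ?_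
    have h3 : p ∣ 2 * i + u ^ 2 := hp.dvd_of_dvd_pow (hw2 ▸ (h1.mul_right _).mul_left _)
    have h4 : p ∣ 2 * i := (Int.dvd_add_left (dvd_pow h1 two_ne_zero)).1 h3
    exact hp.not_isUnit (isUnit_of_dvd_one (Int.dvd_one_of_dvd_sub
      (a := 4 * i + 1 + u * m) (b := 2 * (2 * i) + u * m) (by ring)
      h2 (dvd_add (h4.mul_left 2) (h1.mul_right m))))
  obtain ⟨A, F, hA⟩ := Int.exists_pow_of_isCoprime_mul even_two (huv.mul_right hvn) hw2.symm
  have hA : 2 * u + m = A ^ 2 ∧ u * (4 * i + 1 + u * m) = F ^ 2 := by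
    rcases hA with hA | ⟨hA, -⟩
    · exact hA
    · have : 2 * u + m = 0 := by nlinarith [sq_nonneg A]
      omega
  obtain ⟨B, C, ⟨hB, hC⟩ | ⟨hB, hC⟩⟩ := Int.exists_pow_of_isCoprime_mul even_two hun hA.2
  · subst hB
    obtain rfl : m = A ^ 2 - 2 * B ^ 2 := by linarith
    have hABC : (2 * i + (B ^ 2) ^ 2) ^ 2 = (A * B * C) ^ 2 := by
      rw [hw2, hC]
      ring
    have hAB : IsCoprime A B := by
      rw [← IsCoprime.pow_iff two_pos two_pos (x := A) (y := B)]
      simpa using huv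
    have hA2 : ¬ 2 ∣ A := by
      rintro ⟨l, rfl⟩
      exact hm ⟨2 * l ^ 2 - B ^ 2, by ring⟩
    -- As `2i + B⁴ = ±ABC`, expanding `(C ± AB)²` gives `8i + 1 + 2A²B² = m² + 2A²B²`.
    have hD : ∃ D, A ^ 4 - 2 * A ^ 2 * B ^ 2 + 4 * B ^ 4 = D ^ 2 := by
      rcases sq_eq_sq_iff_eq_or_eq_neg.1 hABC with h | h
      · exact ⟨C + A * B, by linear_combination hC + 2 * h + hi⟩
      · exact ⟨C - A * B, by linear_combination hC + 2 * h + hi⟩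
    obtain ⟨D, hD⟩ := hD
    have hB0 : B = 0 := Int.eq_zero_of_pow_four_sub_two_mul _ rfl hAB hA2 hD
    subst hB0
    obtain rfl : i = 0 := by simpa using hABC
    linarith
  · have h1 : 0 ≤ B ^ 2 := sq_nonneg B
    have h2 : 0 ≤ C ^ 2 := sq_nonneg C
    have h3 : 0 ≤ m := by linarith
    nlinarith [mul_nonneg h3 hv0]

/-- The quartic expressing that `(2m² + 1, -(3m³ + 2m))` is divisible by two in
`y² = x³ - x + m⁶`. -/
theorem sq_eq_one_of_halving_two_mul_sq_add_one {m s : ℤ}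
    (h : s ^ 4 - 6 * (2 * m ^ 2 + 1) * s ^ 2 + 8 * (3 * m ^ 3 + 2 * m) * s
      - 3 * (2 * m ^ 2 + 1) ^ 2 + 4 = 0) : m ^ 2 = 1 := by
  have hs : ¬ 2 ∣ s := by
    rintro ⟨l, rfl⟩
    ring_nf at h
    omega
  have hm : ¬ 2 ∣ m := by
    rintro ⟨l, rfl⟩
    obtain ⟨i, hi⟩ := Int.eight_dvd_sq_sub_one hs
    rw [show s ^ 4 = (s ^ 2) ^ 2 by ring, hi] at h
    ring_nf at h
    omega
  refine sq_eq_one_of_sq_add_sq_sub_one (u := m - s) hm (by omega) ?_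
  linear_combination h

/-- Core of the divisibility analysis of `(-m², m) - (0, m³)` in `y² = x³ - x + m⁶`. -/
theorem sq_add_pow_four_sq_ne {u m : ℤ} (hm : m ≠ 0) :
    (u ^ 2 + (m ^ 2) ^ 2) ^ 2 - 4 * u * m ^ 2 * (u + m ^ 2) ^ 2 ≠
      4 * u * (u ^ 2 - (m ^ 2) ^ 2) := by
  intro h
  have hM0 : 0 < m ^ 2 := by positivity
  have hu0 : u ≠ 0 := by
    rintro rfl
    ring_nf at h
    exact hm (by simpa using h)
  obtain ⟨U, V, hUV, hU, hV⟩ :=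
    Int.exists_gcd_one (m := u) (n := m ^ 2) (Int.gcd_pos_of_ne_zero_left _ hu0)
  have hg0 : (0 : ℤ) < (Int.gcd u (m ^ 2) : ℤ) := by
    exact_mod_cast Int.gcd_pos_of_ne_zero_left _ hu0
  generalize (Int.gcd u (m ^ 2) : ℤ) = g at hU hV hg0
  rw [← Int.isCoprime_iff_gcd_eq_one] at hUV
  have hU0 : U ≠ 0 := by rintro rfl; simp at hU; exact hu0 hU
  have hV0 : 0 < V := by
    by_contra hV0
    nlinarith
  rw [hV, hU] at h
  set Q := (U ^ 2 + V ^ 2) ^ 2 - 4 * U * V * (U + V) ^ 2 with hQ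
  -- The left side is homogeneous of degree 4 in `(u, m²)` and the right of degree 3, so exactly one
  -- factor of the gcd `g` remains. As `Q` is prime to `U`, it follows that `U ∣ g`.
  have h1 : g * Q = 4 * U * (U ^ 2 - V ^ 2) := by
    have h2 : g ^ 3 * (g * Q) = g ^ 3 * (4 * U * (U ^ 2 - V ^ 2)) := by
      rw [hQ]
      linear_combination h
    exact mul_left_cancel₀ (by positivity) h2
  have hUQ : IsCoprime U Q := by
    have : IsCoprime U (V ^ 4) := hUV.pow_right
    have h2 := this.add_mul_left_right (U ^ 3 - 4 * U ^ 2 * V - 6 * U * V ^ 2 - 4 * V ^ 3)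
    rwa [show V ^ 4 + U * (U ^ 3 - 4 * U ^ 2 * V - 6 * U * V ^ 2 - 4 * V ^ 3) = Q by
      rw [hQ]; ring] at h2
  have hVQ : IsCoprime V Q := by
    have : IsCoprime V (U ^ 4) := hUV.symm.pow_right
    have h2 := this.add_mul_left_right (V ^ 3 - 4 * V ^ 2 * U - 6 * V * U ^ 2 - 4 * U ^ 3)
    rwa [show U ^ 4 + V * (V ^ 3 - 4 * V ^ 2 * U - 6 * V * U ^ 2 - 4 * U ^ 3) = Q by
      rw [hQ]; ring] at h2
  obtain ⟨l, rfl⟩ : U ∣ g := hUQ.dvd_of_dvd_mul_right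
    (h1 ▸ ((Dvd.intro_left 4 rfl).mul_right _))
  have h2 : l * Q = 4 * (U ^ 2 - V ^ 2) :=
    mul_left_cancel₀ hU0 (by linear_combination h1)
  have hl0 : l ≠ 0 := by rintro rfl; simp at hg0
  -- If `U = -p < 0`, then `Q ≥ (p + V)⁴/4`, whereas `l ≤ -1` gives `Q ≤ 4(V² - p²)`; hence `(p +
  -- V)³ ≤ 16(V - p)`, which is impossible.
  have hUpos : 0 < U := by
    by_contra hUneg
    have hU' : U < 0 := lt_of_le_of_ne (not_lt.1 hUneg) hU0
    have hl : l ≤ -1 := by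
      by_contra hl
      nlinarith
    obtain ⟨p, rfl⟩ : ∃ p, U = -p := ⟨-U, by ring⟩
    have hp : 0 < p := by linarith
    have hQ' : 4 * Q = (p + V) ^ 4 + 3 * (p - V) ^ 2 * ((p + V) ^ 2 + 4 * p * V) := by
      rw [hQ]; ring
    have hQ4 : (p + V) ^ 4 ≤ 4 * Q := by
      rw [hQ']
      have : 0 < p * V := mul_pos hp hV0
      nlinarith [mul_nonneg (sq_nonneg (p - V)) (add_nonneg (sq_nonneg (p + V))
        (by linarith : 0 ≤ 4 * p * V))]
    have hW4 : 0 < (p + V) ^ 4 := by positivity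
    have hlQ : (p + V) ^ 4 ≤ 16 * ((V - p) * (V + p)) := by nlinarith
    have hW3 : (p + V) ^ 3 ≤ 16 * (V - p) :=
      le_of_mul_le_mul_right (by linarith) (by linarith : 0 < p + V)
    nlinarith [mul_nonneg (by linarith : 0 ≤ p + V) (sq_nonneg (p + V - 4))]
  have hlpos : 0 < l := by
    by_contra h
    nlinarith
  have hmUV : m ^ 2 = U * (V * l) := by rw [hV]; ring
  -- Only the 4 in `lQ = 4(U² - V²)` can keep `l` from being prime to `UV`. If `U` or `V` is even,
  -- `Q` is odd and `k = l/4` works; otherwise `k = l`. Thus `U` and `V` are squares.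
  obtain ⟨k, n, hkn, hkU, hkV⟩ : ∃ k n : ℤ, U * (V * k) = n ^ 2 ∧ IsCoprime k U ∧ IsCoprime k V := by
    by_cases hodd : 2 ∣ U ∨ 2 ∣ V
    · have hsum : IsCoprime 2 (U + V) := by
        rw [Int.prime_two.coprime_iff_not_dvd]
        intro h
        have : 2 ∣ U ∧ 2 ∣ V := by omega
        exact hUV.false_of_prime_dvd Int.prime_two this.1 this.2
      have hsub : IsCoprime 2 (U - V) := by
        have := hsum.add_mul_left_right (-V)
        rwa [show U + V + 2 * -V = U - V by ring] at this
      have hQ2 : IsCoprime 2 Q := by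
        have := (hsub.pow_right (n := 4)).add_mul_left_right (-6 * U ^ 2 * V ^ 2)
        rwa [show (U - V) ^ 4 + 2 * (-6 * U ^ 2 * V ^ 2) = Q by rw [hQ]; ring] at this
      obtain ⟨k, rfl⟩ : 4 ∣ l := by
        have h4 : IsCoprime 4 Q := by simpa using hQ2.pow_left (m := 2)
        exact h4.dvd_of_dvd_mul_right (h2 ▸ Dvd.intro _ rfl)
      have hkQ : k * Q = U ^ 2 - V ^ 2 := by linarith
      obtain ⟨n, rfl⟩ : 2 ∣ m := Int.prime_two.dvd_of_dvd_pow (n := 2) ⟨2 * (U * (V * k)), by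
        rw [hmUV]; ring⟩
      refine ⟨k, n, by linarith, ?_, ?_⟩ <;>
        refine Int.isCoprime_of_forall_prime fun p hp h3 h4 => ?_
      · refine hUV.false_of_prime_dvd hp h4 (hp.dvd_of_dvd_pow (n := 2) ?_)
        rw [show V ^ 2 = U ^ 2 - k * Q by linarith]
        exact dvd_sub (dvd_pow h4 two_ne_zero) (h3.mul_right _)
      · refine hUV.false_of_prime_dvd hp (hp.dvd_of_dvd_pow (n := 2) ?_) h4
        rw [show U ^ 2 = k * Q + V ^ 2 by linarith]
        exact dvd_add (h3.mul_right _) (dvd_pow h4 two_ne_zero)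
    · rw [not_or] at hodd
      have h4 : ∀ {x p : ℤ}, Prime p → ¬ 2 ∣ x → p ∣ x → ¬ p ∣ 2 ^ 2 := fun {x p} hp hx hpx h =>
        ((Int.prime_two.coprime_iff_not_dvd).2 hx).false_of_prime_dvd hp (hp.dvd_of_dvd_pow h) hpx
      refine ⟨l, m, hmUV.symm, ?_, ?_⟩ <;>
        refine Int.isCoprime_of_forall_prime fun p hp h3 h5 => ?_
      · refine hUV.false_of_prime_dvd hp h5 (hp.dvd_of_dvd_pow (n := 2)
          ((hp.dvd_or_dvd ?_).resolve_left (h4 hp hodd.1 h5)))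
        rw [show 2 ^ 2 * V ^ 2 = 4 * U ^ 2 - l * Q by linarith]
        exact dvd_sub ((dvd_pow h5 two_ne_zero).mul_left 4) (h3.mul_right _)
      · refine hUV.false_of_prime_dvd hp (hp.dvd_of_dvd_pow (n := 2)
          ((hp.dvd_or_dvd ?_).resolve_left (h4 hp hodd.2 h5))) h5
        rw [show 2 ^ 2 * U ^ 2 = l * Q + 4 * V ^ 2 by linarith]
        exact dvd_add (h3.mul_right _) ((dvd_pow h5 two_ne_zero).mul_left 4)
  have hsq : ∀ {x y : ℤ}, 0 < x → IsCoprime x y → x * y = n ^ 2 → ∃ b, 0 < b ∧ x = b ^ 2 := by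
    intro x y hx hxy h
    obtain ⟨b, hb⟩ := Int.sq_of_isCoprime hxy h
    have hb : x = b ^ 2 := hb.elim id fun h => by nlinarith [sq_nonneg b]
    refine ⟨|b|, abs_pos.2 ?_, by rw [sq_abs, hb]⟩
    rintro rfl
    simp at hb
    omega
  obtain ⟨b, hb0, hb⟩ := hsq hUpos (hUV.mul_right hkU.symm) hkn
  obtain ⟨c, hc0, hc⟩ := hsq hV0 (hUV.symm.mul_right hkV.symm) (by linarith : V * (U * k) = n ^ 2)
  -- Elimination between `Q` and `4(U² - V²)`, cancelling powers of `U` and `V`, which are prime to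
  -- `Q`.
  have hQ48 : Q ∣ 48 := by
    have h3 : Q ∣ 4 * (U ^ 2 - V ^ 2) := h2 ▸ Dvd.intro_left _ rfl
    have h4 : Q ∣ 16 * (U + 2 * V) := by
      refine (hUQ.symm.pow_right (n := 3)).dvd_of_dvd_mul_left ?_
      rw [show U ^ 3 * (16 * (U + 2 * V)) = Q * -4 -
        4 * (U ^ 2 - V ^ 2) * (V ^ 2 - 4 * U * V - 5 * U ^ 2) by rw [hQ]; ring]
      exact dvd_sub (Dvd.intro _ rfl) (h3.mul_right _)
    have h5 : Q ∣ 16 * (V + 2 * U) := by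
      refine (hVQ.symm.pow_right (n := 3)).dvd_of_dvd_mul_left ?_
      rw [show V ^ 3 * (16 * (V + 2 * U)) = Q * -4 +
        4 * (U ^ 2 - V ^ 2) * (U ^ 2 - 4 * U * V - 5 * V ^ 2) by rw [hQ]; ring]
      exact dvd_add (Dvd.intro _ rfl) (h3.mul_right _)
    refine hVQ.symm.dvd_of_dvd_mul_left ?_
    rw [show V * 48 = 16 * (U + 2 * V) * 2 - 16 * (V + 2 * U) by ring]
    exact dvd_sub (h4.mul_right 2) h5
  -- For `U = b²`, `V = c²` the form `Q` is a difference of two squares. This factor has positive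
  -- terms only, so it bounds `b` and `c`.
  have hG : b ^ 4 + c ^ 4 + 2 * b * c * (b ^ 2 + c ^ 2) ≤ 48 := by
    refine Int.le_of_dvd (by norm_num) (dvd_trans ?_ hQ48)
    exact ⟨b ^ 4 + c ^ 4 - 2 * b * c * (b ^ 2 + c ^ 2), by rw [hQ, hb, hc]; ring⟩
  have hbc : 0 < 2 * b * c * (b ^ 2 + c ^ 2) := by positivity
  have hb3 : b < 3 := by
    by_contra h
    have := pow_le_pow_left₀ (by norm_num) (not_lt.1 h) 4
    have : 0 < c ^ 4 := by positivity
    linarith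
  have hc3 : c < 3 := by
    by_contra h
    have := pow_le_pow_left₀ (by norm_num) (not_lt.1 h) 4
    have : 0 < b ^ 4 := by positivity
    linarith
  rw [hQ, hb, hc] at h2
  clear! u U V k n
  interval_cases b <;> interval_cases c <;> norm_num at h2 <;> omega

/-- The quartic expressing that `(-m², m) - (0, m³)` is divisible by two in
`y² = x³ - x + m⁶`, scaled by `m`. -/
theorem halving_sub_ne_zero {m t : ℤ} (hm : m ≠ 0) :
    t ^ 4 - 6 * (2 * m ^ 4 + 2 * m ^ 2 + 1) * t ^ 2
      - 8 * (m ^ 6 + (m ^ 2 + 1) * (2 * m ^ 4 + 2 * m ^ 2 + 1)) * t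
      - 3 * (2 * m ^ 4 + 2 * m ^ 2 + 1) ^ 2 + 4 * m ^ 4 ≠ 0 := fun h =>
  sq_add_pow_four_sq_ne (u := t + m ^ 2 + 1) hm (by linear_combination h)

/-! ### Absence of rational two-torsion. -/

/-- The coprime factors `x` and `1 - x²` of `m⁶` are squares up to a common sign. Either sign leaves
only `x ∈ {-1, 0, 1}`, where the product vanishes. -/
theorem eq_zero_of_cube_sub_add_pow_six {m x : ℤ} (h : x ^ 3 - x + m ^ 6 = 0) : m = 0 := by
  have hcop : IsCoprime x (1 - x ^ 2) := ⟨x, 1, by ring⟩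
  have hx : x * (1 - x ^ 2) = (m ^ 3) ^ 2 := by linarith
  obtain ⟨a, b, ⟨-, hb⟩ | ⟨-, hb⟩⟩ := Int.exists_pow_of_isCoprime_mul even_two hcop hx
  · have h1 : -1 ≤ x := by nlinarith [sq_nonneg b]
    have h2 : x ≤ 1 := by nlinarith [sq_nonneg b]
    interval_cases x <;> simpa using hx.symm
  · have h1 : (x - b) * (x + b) = 1 := by linarith
    have h2 : x ^ 2 = 1 := by
      rcases Int.mul_eq_one_iff_eq_one_or_neg_one.1 h1 with h | h
      · obtain rfl : x = 1 := by omega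
        rfl
      · obtain rfl : x = -1 := by omega
        rfl
    rw [h2] at hx
    simpa using hx.symm

theorem eq_zero_of_cube_add_sub_pow_six {m x : ℤ} (h : x ^ 3 + x - m ^ 6 = 0) : m = 0 := by
  have hcop : IsCoprime x (x ^ 2 + 1) := ⟨-x, 1, by ring⟩
  have hx : x * (x ^ 2 + 1) = (m ^ 3) ^ 2 := by linarith
  obtain ⟨a, b, ⟨-, hb⟩ | ⟨-, hb⟩⟩ := Int.exists_pow_of_isCoprime_mul even_two hcop hx
  · have h1 : (b - x) * (b + x) = 1 := by linarith
    have h2 : x = 0 := by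
      rcases Int.mul_eq_one_iff_eq_one_or_neg_one.1 h1 with h | h <;> omega
    subst h2
    simpa using hx.symm
  · nlinarith [sq_nonneg b, sq_nonneg x]

/-! ### Halving quartics on `E'_m`. -/

/-- The quartic expressing that `(m², m)` is divisible by two in `y² = x³ + x - m⁶`. -/
theorem halving_sq_ne_zero (m s : ℤ) :
    s ^ 4 - 6 * m ^ 2 * s ^ 2 - 8 * m * s - 3 * m ^ 4 - 4 ≠ 0 := by
  intro h
  rw [show s ^ 4 = (s ^ 2) ^ 2 by ring, show m ^ 4 = (m ^ 2) ^ 2 by ring] at h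
  rcases s.two_dvd_or_sq_eq with ⟨l, rfl⟩ | ⟨i, hi⟩ <;>
    rcases m.two_dvd_or_sq_eq with ⟨k, rfl⟩ | ⟨j, hj⟩
  · ring_nf at h; omega
  · rw [hj] at h; ring_nf at h; omega
  · rw [hi] at h; ring_nf at h; omega
  · rw [hi, hj] at h; ring_nf at h; omega

/-- The quartic expressing that `(k², k³)` is divisible by two in `y² = x³ + x - k²`. -/
theorem halving_sq_cube_ne_zero (k s : ℤ) :
    s ^ 4 - 6 * k ^ 2 * s ^ 2 - 8 * k ^ 3 * s - 3 * k ^ 4 - 4 ≠ 0 := by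
  intro h
  -- The part of the quartic without `a₄` splits because `(k², k³)` lies on the cuspidal cubic `y² =
  -- x³`.
  have h1 : (s + k) ^ 3 * (s - 3 * k) = 4 := by linear_combination h
  have h2 : (s + k) ^ 2 ∣ 4 := ⟨(s + k) * (s - 3 * k), by linear_combination -h1⟩
  have h3 : s + k ∣ 2 := (Int.pow_dvd_pow_iff two_ne_zero).1 (by simpa using h2)
  have h4 := Int.le_of_dvd two_pos h3
  have h5 := Int.le_of_dvd two_pos (neg_dvd.2 h3)
  obtain ⟨t, rfl⟩ : ∃ t, s = t - k := ⟨s + k, by ring⟩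
  simp only [sub_add_cancel] at h1 h4 h5
  have h6 : -2 ≤ t := by linarith
  interval_cases t <;> omega

theorem Int.exists_sq_eq_mul_eq {w p q : ℤ} (h : w ^ 2 = p ^ 2 * q ^ 2) :
    ∃ r, r ^ 2 = p ^ 2 ∧ w = r * q := by
  rw [← mul_pow] at h
  rcases sq_eq_sq_iff_eq_or_eq_neg.1 h with h | h
  · exact ⟨p, rfl, h⟩
  · exact ⟨-p, by ring, by linarith⟩

theorem Int.exists_of_isCoprime_mul_eq_three_mul_sq {r s w : ℤ} (h : IsCoprime r s)
    (e : r * s = 3 * w ^ 2) : ∃ p q, w = p * q ∧ IsCoprime p q ∧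
      (r = 3 * p ^ 2 ∧ s = q ^ 2 ∨ r = -(3 * p ^ 2) ∧ s = -q ^ 2 ∨
        r = p ^ 2 ∧ s = 3 * q ^ 2 ∨ r = -p ^ 2 ∧ s = -(3 * q ^ 2)) := by
  have key : ∀ {r s : ℤ}, IsCoprime r s → r * s = w ^ 2 → ∃ p q, w = p * q ∧ IsCoprime p q ∧
      (r = p ^ 2 ∧ s = q ^ 2 ∨ r = -p ^ 2 ∧ s = -q ^ 2) := by
    intro r s h e
    obtain ⟨p, q, hpq⟩ := Int.exists_pow_of_isCoprime_mul even_two h e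
    obtain ⟨p', hp', hw⟩ := Int.exists_sq_eq_mul_eq (w := w) (p := p) (q := q) (by
      rw [← e]
      rcases hpq with ⟨rfl, rfl⟩ | ⟨rfl, rfl⟩ <;> ring)
    rw [← hp'] at hpq
    refine ⟨p', q, hw, ?_, hpq⟩
    rw [← IsCoprime.pow_iff two_pos two_pos (x := p') (y := q)]
    rcases hpq with ⟨rfl, rfl⟩ | ⟨rfl, rfl⟩
    · exact h
    · simpa only [IsCoprime.neg_left_iff, IsCoprime.neg_right_iff] using h
  rcases Int.prime_three.dvd_or_dvd (Dvd.intro _ e.symm) with ⟨x, rfl⟩ | ⟨x, rfl⟩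
  · obtain ⟨p, q, hw, hpq, h⟩ := key h.of_mul_left_right (by linarith)
    refine ⟨p, q, hw, hpq, ?_⟩
    rcases h with ⟨rfl, rfl⟩ | ⟨rfl, rfl⟩ <;> simp
  · obtain ⟨p, q, hw, hpq, h⟩ := key h.of_mul_right_right (by linarith)
    refine ⟨p, q, hw, hpq, ?_⟩
    rcases h with ⟨rfl, rfl⟩ | ⟨rfl, rfl⟩ <;> simp

theorem Int.exists_pow_four_of_sq_mul_mul {P q t m : ℤ} (hP : P ≠ 0) (h1 : IsCoprime P (q * t))
    (h2 : IsCoprime q t) (h : P ^ 2 * (q * t) = m ^ 4) :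
    ∃ a b c, P ^ 2 = a ^ 4 ∧ (q = b ^ 4 ∧ t = c ^ 4 ∨ q = -b ^ 4 ∧ t = -c ^ 4) := by
  obtain ⟨a, d, ⟨ha, hd⟩ | ⟨ha, -⟩⟩ :=
    Int.exists_pow_of_isCoprime_mul (n := 4) (by decide) h1.pow_left h
  · obtain ⟨b, c, hbc⟩ := Int.exists_pow_of_isCoprime_mul (n := 4) (by decide) h2 hd
    exact ⟨a, b, c, ha, hbc⟩
  · have : 0 < P ^ 2 := by positivity
    have : 0 ≤ a ^ 4 := by positivity
    omega

theorem Int.exists_pow_four_eq_of_not_two_dvd {b : ℤ} (h : ¬ 2 ∣ b) : ∃ i, b ^ 4 = 16 * i + 1 := by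
  obtain ⟨i, hi⟩ := Int.eight_dvd_sq_sub_one h
  exact ⟨4 * i ^ 2 + i, by linear_combination (b ^ 2 + 8 * i + 1) * hi⟩

/-- For coprime odd `b`, `c`, the only solutions of `b⁴ + c⁴ = 2a²` have `b² = c² = 1`. -/
theorem Int.sq_eq_one_of_pow_four_add_pow_four {a b c : ℤ} (hbc : IsCoprime b c) (hb : ¬ 2 ∣ b)
    (hc : ¬ 2 ∣ c) (h : b ^ 4 + c ^ 4 = 2 * a ^ 2) : b ^ 2 = 1 ∧ c ^ 2 = 1 := by
  obtain ⟨i, hi⟩ := Int.eight_dvd_sq_sub_one hb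
  obtain ⟨j, hj⟩ := Int.eight_dvd_sq_sub_one hc
  have hcop : IsCoprime (b ^ 2) (c ^ 2) := hbc.pow
  rw [show b ^ 4 = (b ^ 2) ^ 2 by ring, show c ^ 4 = (c ^ 2) ^ 2 by ring] at h
  obtain ⟨e, he⟩ : ∃ e, b ^ 2 * c ^ 2 = e ^ 2 := ⟨b * c, by ring⟩
  rw [hi, hj] at h hcop he
  -- For `u, v = (b² ± c²)/2` one has `u² + v² = a²` and `u² - v² = (bc)²`.
  have hv : 4 * i - 4 * j = 0 := by
    refine Int.eq_zero_of_sq_add_sq_sub _ rfl (u := 4 * i + 4 * j + 1) (a := a) (e := e) ?_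
      (by linarith) (by linear_combination he)
    refine Int.isCoprime_of_forall_prime fun p hp h1 h2 => hcop.false_of_prime_dvd hp ?_ ?_
    · have := dvd_add h1 h2
      rwa [show 4 * i + 4 * j + 1 + (4 * i - 4 * j) = 8 * i + 1 by ring] at this
    · have := dvd_sub h1 h2
      rwa [show 4 * i + 4 * j + 1 - (4 * i - 4 * j) = 8 * j + 1 by ring] at this
  obtain rfl : i = j := by omega
  rw [isCoprime_self, Int.isUnit_iff] at hcop
  omega

theorem Int.not_three_dvd_sq_add_one (x : ℤ) : ¬ 3 ∣ x ^ 2 + 1 := by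
  obtain ⟨k, hk⟩ : ∃ k, x = 3 * k ∨ x = 3 * k + 1 ∨ x = 3 * k + 2 := ⟨x / 3, by omega⟩
  rcases hk with rfl | rfl | rfl <;> ring_nf <;> omega

theorem Int.isCoprime_three_iff {x : ℤ} : IsCoprime 3 x ↔ ¬ 3 ∣ x :=
  Int.prime_three.coprime_iff_not_dvd

/-- Modulo 3 no square is `-1`, so in `(a² - 1)(a² + 1) = 108b⁸` the factor 27 goes entirely to `a²
- 1`, which yields `(a² + 1)/2 = f⁸`. The same argument on `f⁸ - 1` yields `f⁴ + 1 = 2d²`, hence `f²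
= 1`. -/
theorem eq_zero_of_pow_four_eq {a b : ℤ} (h : a ^ 4 = 1 + 108 * b ^ 8) : b = 0 := by
  have ha : ¬ 2 ∣ a := by
    rintro ⟨k, rfl⟩
    ring_nf at h
    omega
  obtain ⟨i, hi⟩ := Int.eight_dvd_sq_sub_one ha
  have h27 : ∀ {x y : ℤ}, ¬ 3 ∣ y → 27 ∣ x * y → 27 ∣ x := by
    intro x y hy hxy
    have h1 : IsCoprime ((3 : ℤ) ^ 3) y := (Int.isCoprime_three_iff.2 hy).pow_left
    norm_num at h1
    exact h1.dvd_of_dvd_mul_right hxy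
  have hprod : 4 * i * (4 * i + 1) = 27 * b ^ 8 := by
    rw [show a ^ 4 = (a ^ 2) ^ 2 by ring, hi] at h
    linarith
  obtain ⟨x, hx⟩ : 27 ∣ 4 * i := by
    refine h27 (fun h => Int.not_three_dvd_sq_add_one a ?_) ⟨b ^ 8, hprod⟩
    rw [hi]
    omega
  have hxy : x * (4 * i + 1) = b ^ 8 := by
    rw [hx] at hprod ⊢
    linarith
  have hcop : IsCoprime x (4 * i + 1) := ⟨-27, 1, by rw [hx]; ring⟩
  have hi0 : 0 ≤ i := by nlinarith [sq_nonneg a]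
  obtain ⟨e, f, he, hf⟩ :=
    Int.exists_pow_of_isCoprime_mul_of_nonneg (by decide) hcop hxy (by omega) (by omega)
  have hf2 : ¬ 2 ∣ f := by
    rintro ⟨k, rfl⟩
    ring_nf at hf
    omega
  obtain ⟨j, hj⟩ := Int.exists_pow_four_eq_of_not_two_dvd hf2
  have hef : 16 * j * (8 * j + 1) * 2 = 27 * e ^ 8 := by
    rw [show f ^ 8 = (f ^ 4) ^ 2 by ring, hj] at hf
    linarith
  obtain ⟨e, rfl⟩ : 2 ∣ e := Int.prime_two.dvd_of_dvd_pow (n := 8) (by omega)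
  obtain ⟨y, hy⟩ : 27 ∣ j := by
    refine h27 (y := 8 * j + 1) (fun h => Int.not_three_dvd_sq_add_one (f ^ 2) ?_)
      ⟨8 * e ^ 8, by linarith⟩
    rw [show (f ^ 2) ^ 2 = f ^ 4 by ring, hj]
    omega
  have hyj : (2 * y) * (8 * j + 1) = (4 * e ^ 4) ^ 2 := by
    rw [hy] at hef ⊢
    linarith
  have hcop' : IsCoprime (2 * y) (8 * j + 1) := ⟨-(27 * 4), 1, by rw [hy]; ring⟩
  obtain ⟨_, d, hd⟩ := Int.exists_pow_of_isCoprime_mul even_two hcop' hyj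
  have hj0 : 0 ≤ j := by
    have : 0 ≤ f ^ 4 := by positivity
    omega
  have hd' : 8 * j + 1 = d ^ 2 := by
    rcases hd with h | h
    · exact h.2
    · nlinarith [sq_nonneg d]
  obtain ⟨hf1, -⟩ := Int.sq_eq_one_of_pow_four_add_pow_four (a := d) (isCoprime_one_right (x := f))
    hf2 (by norm_num) (by linarith)
  have hj1 : j = 0 := by
    rw [show f ^ 4 = (f ^ 2) ^ 2 by ring, hf1] at hj
    omega
  rw [show f ^ 8 = (f ^ 2) ^ 4 by ring, hf1] at hf
  obtain rfl : i = 0 := by omega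
  simpa using hprod

/-- For odd `u` the factors `z ± 1` of `3u²` are coprime. Two of the four ways to split `3u²` fail
modulo 8; one gives `9b⁴ + c⁴ = 2a²` with `b`, `c` odd, impossible modulo 16; the last gives `b⁴ +
c⁴ = 2a²`. -/
theorem sq_eq_one_of_halving_of_odd {m u z : ℤ} (hu : ¬ 2 ∣ u) (hz : z ^ 2 = 3 * u ^ 2 + 1)
    (hm : 3 * m ^ 4 = u * (2 * z - 3 * u - 2)) : m ^ 2 = 1 := by
  have hz2 : 2 ∣ z := by
    by_contra hz2
    obtain ⟨i, hi⟩ := Int.eight_dvd_sq_sub_one hz2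
    obtain ⟨j, hj⟩ := Int.eight_dvd_sq_sub_one hu
    omega
  have hcop : IsCoprime (z - 1) (z + 1) := by
    obtain ⟨y, rfl⟩ := hz2
    exact ⟨-(y + 1), y, by ring⟩
  obtain ⟨p, q, rfl, hpq, h⟩ :=
    Int.exists_of_isCoprime_mul_eq_three_mul_sq (w := u) hcop (by linear_combination hz)
  have hp : ¬ 2 ∣ p := fun h => hu (h.mul_right q)
  have hq : ¬ 2 ∣ q := fun h => hu (h.mul_left p)
  have hp0 : p ≠ 0 := by rintro rfl; simp at hp
  obtain ⟨i, hi⟩ := Int.eight_dvd_sq_sub_one hp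
  obtain ⟨j, hj⟩ := Int.eight_dvd_sq_sub_one hq
  have h2q : IsCoprime 2 q := (Int.prime_two.coprime_iff_not_dvd).2 hq
  rcases h with ⟨h1, h2⟩ | ⟨h1, h2⟩ | ⟨h1, h2⟩ | ⟨h1, h2⟩
  · omega
  · obtain rfl : z = 1 - 3 * p ^ 2 := by linarith
    have hm' : p ^ 2 * (q * -(2 * p + q)) = m ^ 4 := by linarith
    have hqt : IsCoprime q (-(2 * p + q)) := by
      have := ((h2q.mul_left hpq).add_mul_left_left 1).symm
      rw [mul_one] at this
      exact this.neg_right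
    have hpt : IsCoprime p (-(2 * p + q)) := by
      have := hpq.mul_add_left_right 2
      rw [mul_comm p 2] at this
      exact this.neg_right
    obtain ⟨a, b, c, ha, hbc⟩ :=
      Int.exists_pow_four_of_sq_mul_mul hp0 (hpq.mul_right hpt) hqt hm'
    have hpabc : (2 * p) ^ 2 = (b ^ 4 + c ^ 4) ^ 2 := by
      rcases hbc with ⟨hb, hc⟩ | ⟨hb, hc⟩
      · rw [show 2 * p = -(b ^ 4 + c ^ 4) by linarith, neg_sq]
      · rw [show 2 * p = b ^ 4 + c ^ 4 by linarith]
    have hsum : b ^ 4 + c ^ 4 = 2 * a ^ 2 := by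
      refine (sq_eq_sq₀ (by positivity) (by positivity)).1 ?_
      rw [← hpabc]
      linear_combination 4 * ha
    have hbc2 : IsCoprime b c := by
      rw [← IsCoprime.pow_iff four_pos four_pos (x := b) (y := c)]
      rcases hbc with ⟨hb, hc⟩ | ⟨hb, hc⟩
      · rwa [hc, hb] at hqt
      · rw [hc, hb] at hqt
        simpa only [IsCoprime.neg_left_iff, IsCoprime.neg_right_iff] using hqt
    have hb2 : ¬ 2 ∣ b := by
      intro h
      have := dvd_pow h four_ne_zero
      omega
    have hc2 : ¬ 2 ∣ c := by
      intro h
      have := dvd_pow h four_ne_zero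
      omega
    obtain ⟨hb1, hc1⟩ := Int.sq_eq_one_of_pow_four_add_pow_four hbc2 hb2 hc2 hsum
    rw [show b ^ 4 = (b ^ 2) ^ 2 by ring, show c ^ 4 = (c ^ 2) ^ 2 by ring, hb1, hc1] at hbc hsum
    have ha1 : a ^ 2 = 1 := by linarith
    rw [show a ^ 4 = (a ^ 2) ^ 2 by ring, ha1] at ha
    have hm4 : (m ^ 2) ^ 2 = 1 ^ 2 := by
      rw [← pow_mul, ← hm', ha]
      rcases hbc with ⟨hb, hc⟩ | ⟨hb, hc⟩ <;> rw [hc, hb] <;> norm_num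
    exact (sq_eq_sq₀ (by positivity) (by positivity)).1 hm4
  · obtain rfl : z = p ^ 2 + 1 := by linarith
    exfalso
    have hm' : p ^ 2 * (q * (2 * p - 3 * q)) = 3 * m ^ 4 := by linarith
    have h3p : ¬ 3 ∣ p := by
      rintro ⟨k, rfl⟩
      ring_nf at h2
      omega
    have h3p' : IsCoprime 3 p := Int.isCoprime_three_iff.2 h3p
    have h3q : 3 ∣ q := by
      have h4 : 3 ∣ q * (2 * p - 3 * q) :=
        (h3p'.pow_right (n := 2)).dvd_of_dvd_mul_left ⟨m ^ 4, hm'⟩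
      rcases Int.prime_three.dvd_or_dvd h4 with h | h
      · exact h
      · exact absurd (by omega) h3p
    obtain ⟨k, rfl⟩ := h3q
    have hpk : IsCoprime p k := hpq.of_mul_right_right
    have h2k : IsCoprime 2 k := h2q.of_mul_right_right
    have hm'' : p ^ 2 * (k * (2 * p - 9 * k)) = m ^ 4 := by linarith
    have hkt : IsCoprime k (2 * p - 9 * k) := by
      have := ((h2k.mul_left hpk).symm).add_mul_left_right (-9)
      rwa [show 2 * p + k * -9 = 2 * p - 9 * k by ring] at this
    have hpt : IsCoprime p (2 * p - 9 * k) := by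
      have h9 : IsCoprime p (9 * k) := by
        have := ((h3p'.symm.pow_right (n := 2)).mul_right hpk)
        norm_num at this
        exact this
      have := h9.neg_right.add_mul_left_right 2
      rwa [show -(9 * k) + p * 2 = 2 * p - 9 * k by ring] at this
    obtain ⟨a, b, c, ha, hbc⟩ :=
      Int.exists_pow_four_of_sq_mul_mul hp0 (hpk.mul_right hpt) hkt hm''
    have hpabc : (2 * p) ^ 2 = (9 * b ^ 4 + c ^ 4) ^ 2 := by
      rcases hbc with ⟨hb, hc⟩ | ⟨hb, hc⟩
      · rw [show 2 * p = 9 * b ^ 4 + c ^ 4 by linarith]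
      · rw [show 2 * p = -(9 * b ^ 4 + c ^ 4) by linarith, neg_sq]
    have hsum : 9 * b ^ 4 + c ^ 4 = 2 * a ^ 2 := by
      refine (sq_eq_sq₀ (by positivity) (by positivity)).1 ?_
      rw [← hpabc]
      linear_combination 4 * ha
    have hb2 : ¬ 2 ∣ b := by
      intro h
      have := dvd_pow h four_ne_zero
      omega
    have hc2 : ¬ 2 ∣ c := by
      intro h
      have := dvd_pow h four_ne_zero
      omega
    obtain ⟨r, hr⟩ := Int.exists_pow_four_eq_of_not_two_dvd hb2
    obtain ⟨s, hs⟩ := Int.exists_pow_four_eq_of_not_two_dvd hc2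
    rcases a.two_dvd_or_sq_eq with ⟨l, rfl⟩ | ⟨l, hl⟩
    · ring_nf at hsum
      omega
    · omega
  · omega

theorem Int.three_mul_sq_sub_sq_ne_one (p q : ℤ) : 3 * p ^ 2 - q ^ 2 ≠ 1 := by
  rcases p.two_dvd_or_sq_eq with ⟨l, rfl⟩ | ⟨l, hl⟩ <;>
    rcases q.two_dvd_or_sq_eq with ⟨k, rfl⟩ | ⟨k, hk⟩ <;> ring_nf <;> omega

/-- With `u = 2w`, `z = 2y + 1` the equation becomes `y(y + 1) = 3w²`. Two splittings fail modulo 4.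
The other two make `m⁴` a product of coprime fourth powers up to sign: a parity clash, or Fermat's
`b⁴ + c⁴ = a²` in one and `a⁴ = 1 + 108b⁸` in the other. -/
theorem eq_zero_of_halving_of_even {m u z : ℤ} (hu : 2 ∣ u) (hz : z ^ 2 = 3 * u ^ 2 + 1)
    (hm : 3 * m ^ 4 = u * (2 * z - 3 * u - 2)) : m = 0 := by
  obtain ⟨w, rfl⟩ := hu
  obtain ⟨y, rfl⟩ : ∃ y, z = 2 * y + 1 := by
    have : ¬ 2 ∣ z := by
      rintro ⟨k, rfl⟩
      ring_nf at hz
      omega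
    exact ⟨z / 2, by omega⟩
  by_contra hm0
  obtain ⟨p, q, rfl, hpq, h⟩ := Int.exists_of_isCoprime_mul_eq_three_mul_sq (r := y) (s := y + 1)
    (w := w) ⟨-1, 1, by ring⟩ (by linarith)
  have hp0 : p ≠ 0 := by
    rintro rfl
    simp at hm
    exact hm0 hm
  rcases h with ⟨h1, h2⟩ | ⟨h1, h2⟩ | ⟨h1, h2⟩ | ⟨h1, h2⟩
  · subst h1
    have hm' : (2 * p) ^ 2 * (q * (2 * p - q)) = m ^ 4 := by linarith
    by_cases hq : 2 ∣ q
    · obtain ⟨k, rfl⟩ := hq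
      obtain ⟨n, rfl⟩ : 2 ∣ m := Int.prime_two.dvd_of_dvd_pow (n := 4) ⟨_, by
        rw [← hm', mul_pow, sq 2, mul_assoc, mul_assoc]⟩
      have hn0 : n ≠ 0 := by rintro rfl; simp at hm0
      have hpk : IsCoprime p k := hpq.of_mul_right_right
      have hm'' : p ^ 2 * (k * (p - k)) = n ^ 4 := by linarith
      have hkt : IsCoprime k (p - k) := by
        have := hpk.symm.add_mul_left_right (-1)
        rwa [show p + k * -1 = p - k by ring] at this
      have hpt : IsCoprime p (p - k) := by
        have := hpk.neg_right.add_mul_left_right 1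
        rwa [show -k + p * 1 = p - k by ring] at this
      obtain ⟨a, b, c, ha, hbc⟩ :=
        Int.exists_pow_four_of_sq_mul_mul hp0 (hpk.mul_right hpt) hkt hm''
      have hpabc : p ^ 2 = (b ^ 4 + c ^ 4) ^ 2 := by
        rcases hbc with ⟨hb, hc⟩ | ⟨hb, hc⟩
        · rw [show p = b ^ 4 + c ^ 4 by linarith]
        · rw [show p = -(b ^ 4 + c ^ 4) by linarith, neg_sq]
      have hsum : b ^ 4 + c ^ 4 = a ^ 2 := by
        refine (sq_eq_sq₀ (by positivity) (by positivity)).1 ?_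
        rw [← hpabc]
        linear_combination ha
      have hb0 : b ≠ 0 := by
        rintro rfl
        rcases hbc with ⟨hb, -⟩ | ⟨hb, -⟩ <;> norm_num at hb <;> subst hb <;>
          simp at hm'' <;> exact hn0 (pow_eq_zero_iff four_ne_zero |>.1 hm''.symm)
      have hc0 : c ≠ 0 := by
        rintro rfl
        rcases hbc with ⟨-, hb⟩ | ⟨-, hb⟩ <;> norm_num at hb <;> rw [hb] at hm'' <;>
          simp at hm'' <;> exact hn0 (pow_eq_zero_iff four_ne_zero |>.1 hm''.symm)
      exact not_fermat_42 hb0 hc0 hsum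
    · have h2q : IsCoprime 2 q := (Int.prime_two.coprime_iff_not_dvd).2 hq
      obtain ⟨i, hi⟩ := Int.eight_dvd_sq_sub_one hq
      have hqt : IsCoprime (2 * p) (2 * p - q) := by
        have := (h2q.mul_left hpq).neg_right.add_mul_left_right 1
        rwa [show -q + 2 * p * 1 = 2 * p - q by ring] at this
      have hqt' : IsCoprime q (2 * p - q) := by
        have := (h2q.mul_left hpq).symm.add_mul_left_right (-1)
        rwa [show 2 * p + q * -1 = 2 * p - q by ring] at this
      obtain ⟨a, b, c, ha, hbc⟩ := Int.exists_pow_four_of_sq_mul_mul (by simpa using hp0)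
        ((h2q.mul_left hpq).mul_right hqt) hqt' hm'
      have hp2 : 2 ∣ p := Int.prime_two.dvd_of_dvd_pow (n := 2) (by omega)
      have hb2 : ¬ 2 ∣ b := by
        intro h
        have := dvd_pow h four_ne_zero
        omega
      have hc2 : ¬ 2 ∣ c := by
        intro h
        have := dvd_pow h four_ne_zero
        omega
      obtain ⟨r, hr⟩ := Int.exists_pow_four_eq_of_not_two_dvd hb2
      obtain ⟨s, hs⟩ := Int.exists_pow_four_eq_of_not_two_dvd hc2
      omega
  · exact Int.three_mul_sq_sub_sq_ne_one p q (by linarith)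
  · exact Int.three_mul_sq_sub_sq_ne_one q p (by linarith)
  · obtain rfl : y = -p ^ 2 := h1
    have hm' : (2 * p) ^ 2 * (q * -(2 * p + 3 * q)) = 3 * m ^ 4 := by linarith
    have h3p : ¬ 3 ∣ p := by
      rintro ⟨k, rfl⟩
      ring_nf at h2
      omega
    have h3p' : IsCoprime 3 p := Int.isCoprime_three_iff.2 h3p
    have h3q : 3 ∣ q := by
      have h4 : 3 ∣ q * -(2 * p + 3 * q) :=
        ((Int.isCoprime_three_iff.2 (by omega : ¬ 3 ∣ 2 * p)).pow_right (n := 2)).dvd_of_dvd_mul_left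
          ⟨m ^ 4, hm'⟩
      rcases Int.prime_three.dvd_or_dvd h4 with h | h
      · exact h
      · exact absurd (by omega) h3p
    obtain ⟨k, rfl⟩ := h3q
    have hpk : IsCoprime p k := hpq.of_mul_right_right
    have h9 : IsCoprime p 9 := by
      have := h3p'.symm.pow_right (n := 2)
      norm_num at this
      exact this
    have hm'' : (2 * p) ^ 2 * (k * -(2 * p + 9 * k)) = m ^ 4 := by linarith
    by_cases hk : 2 ∣ k
    · obtain ⟨l, rfl⟩ := hk
      obtain ⟨n, rfl⟩ : 2 ∣ m := Int.prime_two.dvd_of_dvd_pow (n := 4) ⟨_, by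
        rw [← hm'', mul_pow, sq 2, mul_assoc, mul_assoc]⟩
      have hn0 : n ≠ 0 := by rintro rfl; simp at hm0
      have hpl : IsCoprime p l := hpk.of_mul_right_right
      have hn : p ^ 2 * (l * -(p + 9 * l)) = n ^ 4 := by linarith
      have hlt : IsCoprime l (-(p + 9 * l)) := by
        have := (hpl.symm.add_mul_left_right 9).neg_right
        rwa [show p + l * 9 = p + 9 * l by ring] at this
      have hpt : IsCoprime p (-(p + 9 * l)) := by
        have := ((h9.mul_right hpl).add_mul_left_right 1).neg_right
        rwa [show 9 * l + p * 1 = p + 9 * l by ring] at this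
      obtain ⟨a, b, c, ha, hbc⟩ :=
        Int.exists_pow_four_of_sq_mul_mul hp0 (hpl.mul_right hpt) hlt hn
      have hl2 : l ^ 2 = b ^ 8 := by
        rcases hbc with ⟨hb, -⟩ | ⟨hb, -⟩ <;> rw [hb] <;> ring
      obtain rfl : b = 0 := eq_zero_of_pow_four_eq (a := a) (by linarith)
      obtain rfl : l = 0 := by simpa using hl2
      simp at hn
      exact hn0 (pow_eq_zero_iff four_ne_zero |>.1 hn.symm)
    · have h2k : IsCoprime 2 k := (Int.prime_two.coprime_iff_not_dvd).2 hk
      obtain ⟨i, hi⟩ := Int.eight_dvd_sq_sub_one hk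
      have h29 : IsCoprime (2 * p) 9 := IsCoprime.mul_left ⟨-4, 1, by norm_num⟩ h9
      have hpt : IsCoprime (2 * p) (-(2 * p + 9 * k)) := by
        have := ((h29.mul_right (h2k.mul_left hpk)).add_mul_left_right 1).neg_right
        rwa [show 9 * k + 2 * p * 1 = 2 * p + 9 * k by ring] at this
      have hkt : IsCoprime k (-(2 * p + 9 * k)) := by
        have := ((h2k.mul_left hpk).symm.add_mul_left_right 9).neg_right
        rwa [show 2 * p + k * 9 = 2 * p + 9 * k by ring] at this
      obtain ⟨a, b, c, ha, hbc⟩ := Int.exists_pow_four_of_sq_mul_mul (by simpa using hp0)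
        ((h2k.mul_left hpk).mul_right hpt) hkt hm''
      have hp2 : 2 ∣ p := Int.prime_two.dvd_of_dvd_pow (n := 2) (by
        rw [mul_pow] at h2
        omega)
      have hb2 : ¬ 2 ∣ b := by
        intro h
        have := dvd_pow h four_ne_zero
        omega
      have hc2 : ¬ 2 ∣ c := by
        intro h
        have := dvd_pow h four_ne_zero
        omega
      obtain ⟨r, hr⟩ := Int.exists_pow_four_eq_of_not_two_dvd hb2
      obtain ⟨s, hs⟩ := Int.exists_pow_four_eq_of_not_two_dvd hc2
      omega

/-- The quartic expressing that `(m², m) + (m⁶, m⁹)` is divisible by two in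
`y² = x³ + x - m⁶`, scaled by `m`. -/
theorem sq_eq_one_of_halving_add {m t : ℤ} (hm : m ≠ 0)
    (h : t ^ 4 - 6 * (m ^ 4 + 1) * t ^ 2 - 8 * (2 * m ^ 4 + 1) * t - 3 * (m ^ 4 + 1) ^ 2
      - 4 * m ^ 4 = 0) : m ^ 2 = 1 := by
  obtain ⟨u, rfl⟩ : ∃ u, t = u - 1 := ⟨t + 1, by ring⟩
  -- The quartic is quadratic in `m⁴`; completing the square forces `3u² + 1` to be a square `z²`.
  have h1 : (3 * m ^ 4 + u * (3 * u + 2)) ^ 2 = (2 * u) ^ 2 * (3 * u ^ 2 + 1) := by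
    linear_combination -3 * h
  have hu0 : u ≠ 0 := by
    rintro rfl
    simp at h1
    exact hm h1
  obtain ⟨z, hz⟩ : 2 * u ∣ 3 * m ^ 4 + u * (3 * u + 2) :=
    (Int.pow_dvd_pow_iff two_ne_zero).1 (h1 ▸ Dvd.intro _ rfl)
  have hz2 : z ^ 2 = 3 * u ^ 2 + 1 := by
    refine mul_left_cancel₀ (by positivity : (2 * u) ^ 2 ≠ 0) ?_
    rw [← h1, hz]
    ring
  have hm4 : 3 * m ^ 4 = u * (2 * z - 3 * u - 2) := by linarith
  by_cases hu : 2 ∣ u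
  · exact absurd (eq_zero_of_halving_of_even hu hz2 hm4) hm
  · exact sq_eq_one_of_halving_of_odd hu hz2 hm4

/-! ### Independence from indivisibility by two. -/

/-- Without two-torsion a relation whose coefficients are all even can be halved. Repeating this
makes each coefficient divisible by every power of two. -/
theorem linearIndependent_int_of_two_dvd {A ι : Type*} [AddCommGroup A] [Fintype ι]
    (h2 : ∀ a : A, a + a = 0 → a = 0) (v : ι → A)
    (h : ∀ (c : ι → ℤ) (t : A), ∑ i, c i • v i = t + t → ∀ i, 2 ∣ c i) :
    LinearIndependent ℤ v := by
  rw [Fintype.linearIndependent_iff]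
  have key : ∀ (n : ℕ) (g : ι → ℤ), ∑ i, g i • v i = 0 → ∀ i, 2 ^ n ∣ g i := by
    intro n
    induction n with
    | zero => simp
    | succ n ih =>
      intro g hg i
      choose k hk using h g 0 (by simpa using hg)
      rw [hk, pow_succ']
      refine mul_dvd_mul_left 2 (ih k (h2 _ ?_) i)
      rw [← hg, ← Finset.sum_add_distrib]
      exact Finset.sum_congr rfl fun j _ => by rw [hk, two_mul, add_smul]
  intro g hg i
  refine Int.eq_zero_of_abs_lt_dvd (key (g i).natAbs g hg i) ?_
  rw [Int.abs_eq_natAbs]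
  exact_mod_cast Nat.lt_two_pow_self

theorem Int.exists_eq_two_mul_add (c : ℤ) : ∃ q, c = 2 * q ∨ c = 2 * q + 1 :=
  ⟨c / 2, by omega⟩

theorem linearIndependent_int_pair {A : Type*} [AddCommGroup A]
    (h2 : ∀ a : A, a + a = 0 → a = 0) {P Q : A} (hP : ∀ t, P ≠ t + t) (hQ : ∀ t, Q ≠ t + t)
    (hPQ : ∀ t, P + Q ≠ t + t) : LinearIndependent ℤ ![P, Q] := by
  refine linearIndependent_int_of_two_dvd h2 _ fun c t h => ?_
  obtain ⟨q₀, h₀⟩ := (c 0).exists_eq_two_mul_add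
  obtain ⟨q₁, h₁⟩ := (c 1).exists_eq_two_mul_add
  simp only [Fin.sum_univ_two, Matrix.cons_val_zero, Matrix.cons_val_one] at h
  have key : ∀ {X : A}, (∀ t, X ≠ t + t) →
      c 0 • P + c 1 • Q = X + (q₀ • P + q₁ • Q) + (q₀ • P + q₁ • Q) → False := by
    intro X hX h'
    refine hX (t - (q₀ • P + q₁ • Q)) ?_
    rw [h] at h'
    rw [sub_add_sub_comm, h']
    abel
  rcases h₀ with h₀ | h₀ <;> rcases h₁ with h₁ | h₁
  · simp [Fin.forall_fin_two, h₀, h₁]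
  · exact (key hQ (by rw [h₀, h₁]; module)).elim
  · exact (key hP (by rw [h₀, h₁]; module)).elim
  · exact (key hPQ (by rw [h₀, h₁]; module)).elim

/-- Signs are immaterial modulo `2A`. Differences are used because on `E_m` the chords for `R - Q`
and `R - (P + Q)` have the integral slopes `-m` and `m`. -/
theorem linearIndependent_int_triple {A : Type*} [AddCommGroup A]
    (h2 : ∀ a : A, a + a = 0 → a = 0) {P Q R : A} (hP : ∀ t, P ≠ t + t) (hQ : ∀ t, Q ≠ t + t)
    (hPQ : ∀ t, P + Q ≠ t + t) (hR : ∀ t, R ≠ t + t) (hRP : ∀ t, R - P ≠ t + t)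
    (hRQ : ∀ t, R - Q ≠ t + t) (hRPQ : ∀ t, R - (P + Q) ≠ t + t) :
    LinearIndependent ℤ ![P, Q, R] := by
  refine linearIndependent_int_of_two_dvd h2 _ fun c t h => ?_
  obtain ⟨q₀, h₀⟩ := (c 0).exists_eq_two_mul_add
  obtain ⟨q₁, h₁⟩ := (c 1).exists_eq_two_mul_add
  obtain ⟨q₂, h₂⟩ := (c 2).exists_eq_two_mul_add
  simp only [Fin.sum_univ_three, Matrix.cons_val] at h
  have key : ∀ {X Y : A}, (∀ t, X ≠ t + t) →
      c 0 • P + c 1 • Q + c 2 • R = X + Y + Y → False := by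
    intro X Y hX h'
    refine hX (t - Y) ?_
    rw [h] at h'
    rw [sub_add_sub_comm, h']
    abel
  rcases h₀ with h₀ | h₀ <;> rcases h₁ with h₁ | h₁ <;> rcases h₂ with h₂ | h₂
  · simp [Fin.forall_fin_succ, h₀, h₁, h₂]
  · exact (key (Y := q₀ • P + q₁ • Q + q₂ • R) hR (by rw [h₀, h₁, h₂]; module)).elim
  · exact (key (Y := q₀ • P + q₁ • Q + q₂ • R) hQ (by rw [h₀, h₁, h₂]; module)).elim
  · exact (key (Y := q₀ • P + (q₁ + 1) • Q + q₂ • R) hRQ (by rw [h₀, h₁, h₂]; module)).elim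
  · exact (key (Y := q₀ • P + q₁ • Q + q₂ • R) hP (by rw [h₀, h₁, h₂]; module)).elim
  · exact (key (Y := (q₀ + 1) • P + q₁ • Q + q₂ • R) hRP (by rw [h₀, h₁, h₂]; module)).elim
  · exact (key (Y := q₀ • P + q₁ • Q + q₂ • R) hPQ (by rw [h₀, h₁, h₂]; module)).elim
  · exact (key (Y := (q₀ + 1) • P + (q₁ + 1) • Q + q₂ • R) hRPQ
      (by rw [h₀, h₁, h₂]; module)).elim

/-! ### Integrality of rational roots. -/

theorem Rat.exists_int_eq_of_quartic {s : ℚ} {a b c : ℤ}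
    (h : s ^ 4 + a * s ^ 2 + b * s + c = 0) : 
    ∃ n : ℤ, s = n ∧ n ^ 4 + a * n ^ 2 + b * n + c = 0 := by
  have hs : IsIntegral ℤ s := by
    refine ⟨Polynomial.X ^ 4 + (Polynomial.C a * Polynomial.X ^ 2 + Polynomial.C b * Polynomial.X
      + Polynomial.C c), ?_, ?_⟩
    · refine Polynomial.monic_X_pow_add ?_
      compute_degree!
    · simp only [Polynomial.eval₂_add, Polynomial.eval₂_mul, Polynomial.eval₂_pow,
        Polynomial.eval₂_C, Polynomial.eval₂_X]
      simp only [algebraMap_int_eq, eq_intCast]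
      linarith
  obtain ⟨n, hn⟩ := IsIntegrallyClosed.isIntegral_iff.1 hs
  obtain rfl : s = n := by simpa using hn.symm
  exact ⟨n, rfl, by exact_mod_cast h⟩

theorem Rat.exists_int_eq_of_cubic {x : ℚ} {a b : ℤ} (h : x ^ 3 + a * x + b = 0) :
    ∃ n : ℤ, x = n ∧ n ^ 3 + a * n + b = 0 := by
  obtain ⟨n, rfl, -⟩ := Rat.exists_int_eq_of_quartic (a := a) (b := b) (c := 0) (s := x)
    (by push_cast; linear_combination x * h)
  exact ⟨n, rfl, by exact_mod_cast h⟩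

/-! ### Halving points on short Weierstrass curves. -/

namespace WeierstrassCurve.Affine.Point

variable {F : Type*} [Field F] [DecidableEq F] {W : Affine F}

/-- In a short Weierstrass curve, the slope of the tangent line at a point `T` is a root of a
quartic determined by `2T`. -/
theorem exists_slope_of_eq_add_self (h₁ : W.a₁ = 0) (h₂ : W.a₂ = 0) (h₃ : W.a₃ = 0) {x y : F}
    {h : W.Nonsingular x y} {T : W.Point} (hT : some x y h = T + T) :
    ∃ s, s ^ 4 - 6 * x * s ^ 2 - 8 * y * s - 3 * x ^ 2 - 4 * W.a₄ = 0 := by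
  rcases T with _ | ⟨u, v, huv⟩
  · exact absurd hT (by rw [← zero_def, add_zero]; exact some_ne_zero h)
  by_cases hv : v = W.negY u v
  · rw [add_self_of_Y_eq hv] at hT
    exact absurd hT (some_ne_zero h)
  · rw [add_self_of_Y_ne hv] at hT
    obtain ⟨hx, hy⟩ := some.inj hT
    refine ⟨W.slope u u v v, ?_⟩
    -- The quartic arises by putting `u = (s² - x)/2` and `v = s(u - x) - y` into this tangent
    -- relation.
    have hs : W.slope u u v v * (2 * v) = 3 * u ^ 2 + W.a₄ := by
      have hd : 2 * v = v - W.negY u v := by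
        rw [negY, h₁, h₃]
        ring
      rw [slope_of_Y_ne rfl hv, h₁, h₂, hd, div_mul_cancel₀ _ (sub_ne_zero.2 hv)]
      ring
    clear hT
    generalize W.slope u u v v = s at *
    simp only [addY, negAddY, addX, negY, h₁, h₂, h₃] at hx hy
    subst hx hy
    linear_combination 4 * hs

theorem exists_slope_of_add_eq_add_self (h₁ : W.a₁ = 0) (h₂ : W.a₂ = 0) (h₃ : W.a₃ = 0)
    {x₁ y₁ x₂ y₂ x y l : F} {h : W.Nonsingular x₁ y₁} {h' : W.Nonsingular x₂ y₂} {T : W.Point}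
    (hT : some x₁ y₁ h + some x₂ y₂ h' = T + T) (hx : x₁ ≠ x₂) (hl : l * (x₁ - x₂) = y₁ - y₂)
    (hx' : x = l ^ 2 - x₁ - x₂) (hy' : y = l * (x₁ - x) - y₁) :
    ∃ s, s ^ 4 - 6 * x * s ^ 2 - 8 * y * s - 3 * x ^ 2 - 4 * W.a₄ = 0 := by
  rw [add_of_X_ne hx] at hT
  obtain ⟨s, hs⟩ := exists_slope_of_eq_add_self h₁ h₂ h₃ hT
  refine ⟨s, ?_⟩
  rw [slope_of_X_ne hx, ← hl, mul_div_cancel_right₀ _ (sub_ne_zero.2 hx)] at hs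
  simp only [addY, negAddY, addX, negY, h₁, h₂, h₃] at hs
  subst hx' hy'
  linear_combination hs

theorem exists_slope_of_sub_eq_add_self (h₁ : W.a₁ = 0) (h₂ : W.a₂ = 0) (h₃ : W.a₃ = 0)
    {x₁ y₁ x₂ y₂ x y l : F} {h : W.Nonsingular x₁ y₁} {h' : W.Nonsingular x₂ y₂} {T : W.Point}
    (hT : some x₁ y₁ h - some x₂ y₂ h' = T + T) (hx : x₁ ≠ x₂) (hl : l * (x₁ - x₂) = y₁ + y₂)
    (hx' : x = l ^ 2 - x₁ - x₂) (hy' : y = l * (x₁ - x) - y₁) :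
    ∃ s, s ^ 4 - 6 * x * s ^ 2 - 8 * y * s - 3 * x ^ 2 - 4 * W.a₄ = 0 := by
  rw [sub_eq_add_neg, neg_some] at hT
  exact exists_slope_of_add_eq_add_self h₁ h₂ h₃ hT hx (by simp [negY, h₁, h₃, hl]) hx' hy'

/-- In a short Weierstrass curve in characteristic not two, a nonzero point of order two gives a
root of the cubic. -/
theorem eq_zero_of_add_self_eq_zero (h₁ : W.a₁ = 0) (h₂ : W.a₂ = 0) (h₃ : W.a₃ = 0)
    (hF : (2 : F) ≠ 0) (hW : ∀ x, x ^ 3 + W.a₄ * x + W.a₆ ≠ 0) {T : W.Point}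
    (hT : T + T = 0) : T = 0 := by
  rcases T with _ | ⟨u, v, huv⟩
  · rfl
  · by_cases hv : v = W.negY u v
    · have hv0 : v = 0 := by
        simp only [negY, h₁, h₃] at hv
        have : 2 * v = 0 := by linear_combination hv
        exact (mul_eq_zero.1 this).resolve_left hF
      have := (W.equation_iff u v).1 huv.1
      rw [hv0, h₁, h₂, h₃] at this
      exact absurd (by linear_combination -this) (hW u)
    · rw [add_self_of_Y_ne hv] at hT
      exact absurd hT (some_ne_zero _)

end WeierstrassCurve.Affine.Point

/-! ### The rank bounds. -/

open WeierstrassCurve.Affine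

theorem curveE_eq_zero_of_add_self {m : ℤ} (hm : m ≠ 0) (T : (curveE m).toAffine.Point)
    (hT : T + T = 0) : T = 0 := by
  refine Point.eq_zero_of_add_self_eq_zero rfl rfl rfl two_ne_zero (fun x hx => hm ?_) hT
  obtain ⟨n, -, hn⟩ := Rat.exists_int_eq_of_cubic (x := x) (a := -1) (b := m ^ 6)
    (by push_cast; exact hx)
  exact eq_zero_of_cube_sub_add_pow_six (x := n) (by linarith)

theorem curveE'_eq_zero_of_add_self {m : ℤ} (hm : m ≠ 0) (T : (curveE' m).toAffine.Point)
    (hT : T + T = 0) : T = 0 := by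
  refine Point.eq_zero_of_add_self_eq_zero rfl rfl rfl two_ne_zero (fun x hx => hm ?_) hT
  obtain ⟨n, -, hn⟩ := Rat.exists_int_eq_of_cubic (x := x) (a := 1) (b := -m ^ 6)
    (by push_cast; exact hx)
  exact eq_zero_of_cube_add_sub_pow_six (x := n) (by linarith)

theorem three_le_mordellWeilRank_curveE {m : ℤ} (hm : 1 < m) :
    3 ≤ mordellWeilRank (curveE m) := by
  have hm0 : m ≠ 0 := by omega
  have hmQ : (m : ℚ) ≠ 0 := by exact_mod_cast hm0
  have hm2 : m ^ 2 ≠ 1 := by nlinarith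
  have hm2Q : (m : ℚ) ^ 2 ≠ 1 := by exact_mod_cast hm2
  have hm2pos : (0 : ℚ) < (m : ℚ) ^ 2 := by positivity
  let P : (curveE m).toAffine.Point :=
    .mk ((curveE_equation m 0 ((m : ℚ) ^ 3)).2 (by ring))
  let Q : (curveE m).toAffine.Point :=
    .mk ((curveE_equation m 1 ((m : ℚ) ^ 3)).2 (by ring))
  let R : (curveE m).toAffine.Point :=
    .mk ((curveE_equation m (-(m : ℚ) ^ 2) m).2 (by ring))
  let S : (curveE m).toAffine.Point :=
    .mk ((curveE_equation m (-1) (-(m : ℚ) ^ 3)).2 (by ring))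
  -- The horizontal line `y = m³` meets the curve at `x = 0, 1, -1`.
  have hS : P + Q = S := by
    refine (Point.add_of_X_ne (by norm_num)).trans ?_
    refine (Point.some.injEq ..).mpr ?_
    rw [slope_of_X_ne (by norm_num)]
    simp [addX, addY, negAddY, negY, curveE]
  have hli : LinearIndependent ℤ ![P, Q, R] := by
    refine linearIndependent_int_triple (curveE_eq_zero_of_add_self hm0) (fun T hT => ?_)
      (fun T hT => ?_) (fun T hT => ?_) (fun T hT => ?_) (fun T hT => ?_) (fun T hT => ?_)
      (fun T hT => ?_)
    · obtain ⟨s, hs⟩ := Point.exists_slope_of_eq_add_self rfl rfl rfl hT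
      simp only [curveE] at hs
      obtain ⟨n, -, hn⟩ := Rat.exists_int_eq_of_quartic (s := s) (a := 0) (b := -8 * m ^ 3)
        (c := 4) (by push_cast; linear_combination hs)
      exact pow_four_sub_ne_zero (m ^ 3) n (by linear_combination hn)
    · obtain ⟨s, hs⟩ := Point.exists_slope_of_eq_add_self rfl rfl rfl hT
      simp only [curveE] at hs
      obtain ⟨n, -, hn⟩ := Rat.exists_int_eq_of_quartic (s := s) (a := -6) (b := -8 * m ^ 3)
        (c := 1) (by push_cast; linear_combination hs)
      exact pow_four_sub_six_mul_ne_zero (m ^ 3) n (by linear_combination hn)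
    · rw [hS] at hT
      obtain ⟨s, hs⟩ := Point.exists_slope_of_eq_add_self rfl rfl rfl hT
      simp only [curveE] at hs
      obtain ⟨n, -, hn⟩ := Rat.exists_int_eq_of_quartic (s := s) (a := 6) (b := 8 * m ^ 3)
        (c := 1) (by push_cast; linear_combination hs)
      have := sq_eq_one_of_pow_four_add_six_mul (k := m ^ 3) (s := n) (by linear_combination hn)
      exact (one_lt_pow₀ (one_lt_pow₀ hm three_ne_zero) two_ne_zero).ne' this
    · obtain ⟨s, hs⟩ := Point.exists_slope_of_eq_add_self rfl rfl rfl hT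
      simp only [curveE] at hs
      obtain ⟨n, -, hn⟩ := Rat.exists_int_eq_of_quartic (s := s) (a := 6 * m ^ 2) (b := -8 * m)
        (c := -3 * m ^ 4 + 4) (by push_cast; linear_combination hs)
      exact hm2 (sq_eq_one_of_halving_neg_sq (s := n) (by linear_combination hn))
    · obtain ⟨s, hs⟩ := Point.exists_slope_of_sub_eq_add_self rfl rfl rfl hT
        (l := -((m : ℚ) ^ 2 + 1) / m) (by linarith) (by field_simp; ring) rfl rfl
      simp only [curveE] at hs
      -- `R - P` has abscissa `(2m⁴ + 2m² + 1)/m²`, so `ms`, rather than `s`, is a root of an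
      -- integral quartic.
      obtain ⟨n, -, hn⟩ := Rat.exists_int_eq_of_quartic (s := m * s)
        (a := -6 * (2 * m ^ 4 + 2 * m ^ 2 + 1))
        (b := -8 * (m ^ 6 + (m ^ 2 + 1) * (2 * m ^ 4 + 2 * m ^ 2 + 1)))
        (c := -3 * (2 * m ^ 4 + 2 * m ^ 2 + 1) ^ 2 + 4 * m ^ 4) (by
          push_cast
          field_simp at hs
          linear_combination hs)
      exact halving_sub_ne_zero (t := n) hm0 (by linear_combination hn)
    · obtain ⟨s, hs⟩ := Point.exists_slope_of_sub_eq_add_self rfl rfl rfl hT (l := -(m : ℚ))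
        (by linarith) (by ring) rfl rfl
      simp only [curveE] at hs
      obtain ⟨n, -, hn⟩ := Rat.exists_int_eq_of_quartic (s := s) (a := -6 * (2 * m ^ 2 - 1))
        (b := -8 * (3 * m ^ 3 - 2 * m)) (c := -3 * (2 * m ^ 2 - 1) ^ 2 + 4)
        (by push_cast; linear_combination hs)
      exact halving_two_mul_sq_sub_one_ne_zero m n (by linear_combination hn)
    · rw [hS] at hT
      obtain ⟨s, hs⟩ := Point.exists_slope_of_sub_eq_add_self rfl rfl rfl hT (l := (m : ℚ))
        (fun h => hm2Q (by linarith)) (by ring) rfl rfl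
      simp only [curveE] at hs
      obtain ⟨n, -, hn⟩ := Rat.exists_int_eq_of_quartic (s := s) (a := -6 * (2 * m ^ 2 + 1))
        (b := 8 * (3 * m ^ 3 + 2 * m)) (c := -3 * (2 * m ^ 2 + 1) ^ 2 + 4)
        (by push_cast; linear_combination hs)
      exact hm2 (sq_eq_one_of_halving_two_mul_sq_add_one (s := n) (by linear_combination hn))
  have := hli.cardinal_lift_le_rank
  simpa [mordellWeilRank] using this

theorem two_le_mordellWeilRank_curveE' {m : ℤ} (hm : 1 < m) :
    2 ≤ mordellWeilRank (curveE' m) := by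
  have hm0 : m ≠ 0 := by omega
  have hmQ : (m : ℚ) ≠ 0 := by exact_mod_cast hm0
  have hm2 : m ^ 2 ≠ 1 := by nlinarith
  let P : (curveE' m).toAffine.Point :=
    .mk ((curveE'_equation m ((m : ℚ) ^ 2) m).2 (by ring))
  let Q : (curveE' m).toAffine.Point :=
    .mk ((curveE'_equation m ((m : ℚ) ^ 6) ((m : ℚ) ^ 9)).2 (by ring))
  have hx : (m : ℚ) ^ 2 ≠ (m : ℚ) ^ 6 :=
    (pow_lt_pow_right₀ (by exact_mod_cast hm) (by norm_num)).ne
  have hli : LinearIndependent ℤ ![P, Q] := by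
    refine linearIndependent_int_pair (curveE'_eq_zero_of_add_self hm0) (fun T hT => ?_)
      (fun T hT => ?_) (fun T hT => ?_)
    · obtain ⟨s, hs⟩ := Point.exists_slope_of_eq_add_self rfl rfl rfl hT
      simp only [curveE'] at hs
      obtain ⟨n, -, hn⟩ := Rat.exists_int_eq_of_quartic (s := s) (a := -6 * m ^ 2) (b := -8 * m)
        (c := -3 * m ^ 4 - 4) (by push_cast; linear_combination hs)
      exact halving_sq_ne_zero m n (by linear_combination hn)
    · obtain ⟨s, hs⟩ := Point.exists_slope_of_eq_add_self rfl rfl rfl hT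
      simp only [curveE'] at hs
      obtain ⟨n, -, hn⟩ := Rat.exists_int_eq_of_quartic (s := s) (a := -6 * m ^ 6)
        (b := -8 * m ^ 9) (c := -3 * m ^ 12 - 4) (by push_cast; linear_combination hs)
      exact halving_sq_cube_ne_zero (m ^ 3) n (by linear_combination hn)
    · obtain ⟨s, hs⟩ := Point.exists_slope_of_add_eq_add_self rfl rfl rfl hT
        (l := ((m : ℚ) ^ 4 + 1) / m) hx (by field_simp; ring) rfl rfl
      simp only [curveE'] at hs
      -- `P + Q` is `((m⁴ + 1)/m², -(2m⁴ + 1)/m³)`: the factor `m` clears denominators and the sign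
      -- turns the linear coefficient negative.
      obtain ⟨n, -, hn⟩ := Rat.exists_int_eq_of_quartic (s := -(m * s)) (a := -6 * (m ^ 4 + 1))
        (b := -8 * (2 * m ^ 4 + 1)) (c := -3 * (m ^ 4 + 1) ^ 2 - 4 * m ^ 4) (by
          push_cast
          field_simp at hs
          linear_combination hs)
      exact hm2 (sq_eq_one_of_halving_add (t := n) hm0 (by linear_combination hn))
  have := hli.cardinal_lift_le_rank
  simpa [mordellWeilRank] using this

theorem theorem1p5 (m : ℤ) (hm : 1 < m) :
    3 ≤ mordellWeilRank (curveE m) ∧ 2 ≤ mordellWeilRank (curveE' m) := by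
  exact ⟨three_le_mordellWeilRank_curveE hm, two_le_mordellWeilRank_curveE' hm⟩
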